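/- Let $d\ge 1$ and $k\ge 2$ be integers and let $\alpha\in(0,1]$ with $k>2-\alpha+\frac d2$. For a function $f$ on the cube $[0,1]^d$ with values in $\mathbb R^m$ write $f\in C^{k,\alpha}$ if $f$ is continuous, is $k$ times continuously differentiable in the interior, its partial derivatives $D_\beta f$ with $|\beta|\le k$ extend continuously to $[0,1]^d$, and the extended derivatives $D_\beta f$ with $|\beta|=k$ are $\alpha$-Hölder continuous. Put $$\|f\|_{C^{k,\alpha}}=\max_{|\beta|\le k}\ \sup_{x\in[0,1]^d}|D_\beta f(x)|+\max_{|\beta|=k}\ \sup_{x\ne y}\frac{|D_\beta f(x)-D_\beta f(y)|}{|x-y|^\alpha},$$ where $|\cdot|$ is the Euclidean norm on vectors. Let $K,\hat K,C_1,C_2>0$ and $B\in(0,\frac12)$. Let $\mathcal H^G$ be the set of all bijections $\phi:[0,1]^d\to[0,1]^d$ with $\phi,\phi^{-1}\in C^{k,\alpha}$, $\|\phi\|_{C^{k,\alpha}}\le K$ and $\|\phi^{-1}\|_{C^{k,\alpha}}\le\hat K$. Let $\mathcal H^D$ be the set of all $\xi:[0,1]^d\to(0,1)$ with $B\le\xi\le1-B$,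 $\xi\in C^{k-1,\alpha}$, $\|\xi\|_{C^{k-1,\alpha}}\le C_2$ and $\|D\xi\|_\infty\le C_1$. Let $\lambda$ be the uniform distribution on $[0,1]^d$ and let $Z_1,Z_2,\dots$ be independent random variables with distribution $\lambda$ on a probability space $(\Omega,\mathcal F,\mathbb P)$. For $n\in\mathbb N$ define $$\varepsilon^\lambda_{\mathrm{gen}}(n)=\sup_{\phi\in\mathcal H^G,\ \xi\in\mathcal H^D}\Bigl|\frac1n\sum_{i=1}^n\log\bigl(1-\xi(\phi(Z_i))\bigr)-\int_{[0,1]^d}\log\bigl(1-\xi(\phi(z))\bigr)\,d\lambda(z)\Bigr|$$ (with the supremum equal to $0$ if $\mathcal H^G$ or $\mathcal H^D$ is empty). Let $\tau>\sqrt{2(\log B)^2}$. Then for $\mathbb P$-almost every $\omega\in\Omega$ there is a natural number $N(\omega)$ such that $$\varepsilon^\lambda_{\mathrm{gen}}(n)<\tau\sqrt{\frac{\log n}{n}}\qquad\text{for all } n\ge N(\omega).$$ -/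

import Mathlib

open MeasureTheory ProbabilityTheory Set Topology
open scoped ENNReal

namespace GAL

noncomputable section

/-- Euclidean space `ℝ^d`, with the norm `|x| = (∑ x_i ^ 2) ^ (1/2)`. -/
abbrev E (d : ℕ) : Type := EuclideanSpace ℝ (Fin d)

/-- The unit cube `[0,1]^d`. -/
def cube (d : ℕ) : Set (E d) := {x | ∀ i, x i ∈ Icc (0 : ℝ) 1}

/-- The noise measure: the uniform distribution on `[0,1]^d`, that is, Lebesgue measure restricted
to the cube (which has Lebesgue measure one). -/
def noiseMeasure (d : ℕ) : Measure (E d) := volume.restrict (cube d)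

/-! ### Hölder spaces on the cube

Functions on the cube are represented by functions on all of `ℝ^d`; everything below depends only
on their values on the cube. -/

section Holder

variable {d : ℕ} {F : Type*} [NormedAddCommGroup F] [NormedSpace ℝ F]

/-- The partial derivative `D_β f = ∂^|β| f / ∂x_1^β_1 ⋯ ∂x_d^β_d` for a multi-index `β`: the
derivative of order `|β|`, evaluated at the list of basis vectors in which the `i`-th one occurs
`β i` times. -/
def multiDeriv (β : Fin d → ℕ) (f : E d → F) (x : E d) : F :=
  iteratedFDeriv ℝ (∑ i, β i) f x
    (fun j => EuclideanSpace.single (finSigmaFinEquiv.symm j).1 (1 : ℝ))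

/-- The continuous extension to the cube of a function given on the interior of the cube
(meaningful whenever such an extension exists). -/
def cubeExt (g : E d → F) : E d → F := extendFrom (interior (cube d)) g

/-- `f ∈ C^k([0,1]^d, F)`: `f` is continuous on the cube, `k` times continuously differentiable in
the interior, and the partial derivatives of order at most `k` extend continuously to the cube. -/
def MemCk (k : ℕ) (f : E d → F) : Prop :=
  ContinuousOn f (cube d) ∧
  ContDiffOn ℝ k f (interior (cube d)) ∧
  ∀ β : Fin d → ℕ, ∑ i, β i ≤ k →
    ∃ g : E d → F, ContinuousOn g (cube d) ∧ EqOn g (multiDeriv β f) (interior (cube d))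

/-- `‖f‖_{C^k} = max_{|β| ≤ k} sup_{x ∈ [0,1]^d} |D_β f(x)|`. -/
def ckNorm (k : ℕ) (f : E d → F) : ℝ≥0∞ :=
  ⨆ (β : Fin d → ℕ) (_ : ∑ i, β i ≤ k) (x ∈ cube d), ‖cubeExt (multiDeriv β f) x‖ₑ

/-- The `α`-Hölder coefficient `[g]_α = sup_{x ≠ y} |g(x) - g(y)| / |x - y|^α` on the cube. -/
def holderCoeff (α : ℝ) (g : E d → F) : ℝ≥0∞ :=
  ⨆ (x ∈ cube d) (y ∈ cube d) (_ : x ≠ y), ‖g x - g y‖ₑ / ‖x - y‖ₑ ^ α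

/-- `‖f‖_{C^{k,α}} = ‖f‖_{C^k} + max_{|β| = k} [D_β f]_α`. -/
def holderNorm (k : ℕ) (α : ℝ) (f : E d → F) : ℝ≥0∞ :=
  ckNorm k f + ⨆ (β : Fin d → ℕ) (_ : ∑ i, β i = k), holderCoeff α (cubeExt (multiDeriv β f))

/-- `f ∈ C^{k,α}([0,1]^d, F)`. -/
def MemHolder (k : ℕ) (α : ℝ) (f : E d → F) : Prop :=
  MemCk k f ∧
  ∀ β : Fin d → ℕ, ∑ i, β i = k → holderCoeff α (cubeExt (multiDeriv β f)) < ∞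

end Holder

/-! ### Hypothesis spaces -/

/-- The generators: bijections `φ` of the cube such that `φ` and `φ⁻¹` are of class `C^{k,α}` with
norms at most `K` and `K'`. -/
def generators (d k : ℕ) (α K K' : ℝ) : Set (E d → E d) :=
  {φ | MemHolder k α φ ∧ holderNorm k α φ ≤ ENNReal.ofReal K ∧
    BijOn φ (cube d) (cube d) ∧
    ∃ ψ : E d → E d, InvOn ψ φ (cube d) (cube d) ∧
      MemHolder k α ψ ∧ holderNorm k α ψ ≤ ENNReal.ofReal K'}

/-- The discriminators: functions `ξ` on the cube with `B ≤ ξ ≤ 1 - B`, with `‖Dξ‖_∞ ≤ C₁`, and of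
class `C^{k-1,α}` with norm at most `C₂` (for `k ≥ 2`). -/
def discriminators (d k : ℕ) (α B C₁ C₂ : ℝ) : Set (E d → ℝ) :=
  {ξ | (∀ x ∈ cube d, B ≤ ξ x ∧ ξ x ≤ 1 - B) ∧
    (∀ x ∈ cube d, ‖cubeExt (fderiv ℝ ξ) x‖ ≤ C₁) ∧
    MemHolder (k - 1) α ξ ∧ holderNorm (k - 1) α ξ ≤ ENNReal.ofReal C₂}

/-! ### Risk functions and the generalization error -/

/-- The noise part of the risk, `E_{Z ∼ U([0,1]^d)} [log (1 - ξ(φ(Z)))]`. -/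
def noiseRisk {d : ℕ} (φ : E d → E d) (ξ : E d → ℝ) : ℝ :=
  ∫ z, Real.log (1 - ξ (φ z)) ∂(noiseMeasure d)

/-- The noise part of the empirical risk, `(1/n) ∑ log (1 - ξ(φ(z_i)))`, for the first `n` terms of
the sequence `z` of noise samples. -/
def empNoiseRisk {d : ℕ} (z : ℕ → E d) (n : ℕ) (φ : E d → E d) (ξ : E d → ℝ) : ℝ :=
  (1 / (n : ℝ)) * ∑ i ∈ Finset.range n, Real.log (1 - ξ (φ (z i)))

/-- The noise generalization error: the supremum of `|empirical risk - risk|` over generators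
`φ ∈ G` and discriminators `ξ ∈ D`, for the noise samples `z`. It is taken in `[0,∞]`, so that it is
the true supremum in all cases. -/
def noiseGenError {d : ℕ} (G : Set (E d → E d)) (D : Set (E d → ℝ)) (z : ℕ → E d) (n : ℕ) : ℝ≥0∞ :=
  ⨆ (φ ∈ G) (ξ ∈ D), ENNReal.ofReal |empNoiseRisk z n φ ξ - noiseRisk φ ξ|

end

end GAL

/-! Write `M = |log B|`. Every loss `log (1 - ξ ∘ φ)` takes values in `[-M, 0]`, and the uniform law
splits into concentration of the supremum of the deviations and a bound for its mean.

Concentration: replacing one of `n` samples moves the supremum by at most `M / n`, so bounded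
differences (`measureReal_pi_ge_le`) bound the probability of exceeding the mean by `ε` by `exp (-n
ε² / (2 M²))`. For `ε = τ' √(log n / n)` this is `n ^ (-τ'² / (2 M²))`, summable exactly when `τ' >
√2 M`; this is the threshold `√(2 (log B)²)`. Borel–Cantelli then gives the almost sure statement
(`ae_eventually_supDev_lt`), provided that the mean is `O(1 / √n)`, which is negligible against
`√(log n / n)`.

Mean (`exists_integral_supDev_le`): by the chain rule the losses have `k - 1` uniformly bounded
derivatives (`exists_smoothBound_lossFun`), and `k - 1 > d / 2`. Approximating by Taylor polynomials
on dyadic cubes and telescoping over scales (`exists_dyadic_decomposition`) writes each loss as a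
combination of fixed functions, finitely many on each of the `2^(jd)` cubes of scale `j`, with
coefficients `O(2^(-j(k-1)))`. Since the fixed functions do not depend on the loss, the supremum is
at most a weighted sum of their absolute deviations, each of mean `O(2^(-jd/2) / √n)` by the
variance bound. Scale `j` contributes `O(2^(-j(k-1-d/2)) / √n)`, a convergent geometric series.

The chain rule in the open cube needs that generators preserve it (`mapsTo_interior_cube`), and
reading operator norms off partial derivatives needs symmetry of higher derivatives. A countable
uniformly dense family of losses makes the supremum measurable. -/

namespace GAL

/-! ### Concentration by bounded differences -/

section BoundedDifferences

variable {X : Type*} [MeasurableSpace X]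

lemma integral_pi_fin_succ (μ : Measure X) [IsProbabilityMeasure μ] {n : ℕ}
    {g : (Fin (n + 1) → X) → ℝ} (hg : Measurable g) {C : ℝ} (hC : ∀ z, |g z| ≤ C) :
    ∫ z, g z ∂(Measure.pi fun _ : Fin (n + 1) => μ) =
      ∫ z, ∫ x, g (Fin.cons x z) ∂μ ∂(Measure.pi fun _ : Fin n => μ) := by
  have h1 := (measurePreserving_piFinSuccAbove (fun _ : Fin (n + 1) => μ) 0).symm
  have h2 : ∀ p : X × (Fin n → X),
      (MeasurableEquiv.piFinSuccAbove (fun _ : Fin (n + 1) => X) 0).symm p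
        = (Fin.cons p.1 p.2 : Fin (n + 1) → X) := fun p => by
    simp [MeasurableEquiv.piFinSuccAbove, Fin.insertNthEquiv]
  rw [← h1.integral_comp' (g := g)]
  simp only [h2]
  have hm : Measurable fun p : X × (Fin n → X) => (Fin.cons p.1 p.2 : Fin (n + 1) → X) := by
    rw [← funext h2]
    exact MeasurableEquiv.measurable _
  have := integral_prod_symm (μ := μ) (ν := Measure.pi fun _ : Fin n => μ)
    (fun p : X × (Fin n → X) => g (Fin.cons p.1 p.2)) ?_
  · simpa using this
  · exact Integrable.of_bound (hg.comp hm).aestronglyMeasurable C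
      (Filter.Eventually.of_forall fun p => by simpa using hC _)

lemma measurable_fin_cons {n : ℕ} :
    Measurable fun p : X × (Fin n → X) => (Fin.cons p.1 p.2 : Fin (n + 1) → X) := by
  refine measurable_pi_iff.2 fun i => ?_
  refine Fin.cases ?_ (fun j => ?_) i
  · simpa using measurable_fst
  · simpa [Function.comp_def] using
      (measurable_pi_apply (X := fun _ : Fin n => X) j).comp measurable_snd

/-- Azuma's form of the bounded differences inequality, on the level of moment generating
functions. -/
theorem integral_exp_sub_integral_le (μ : Measure X) [IsProbabilityMeasure μ] (c t : ℝ)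
    (n : ℕ) (S : (Fin n → X) → ℝ) (hS : Measurable S) (C : ℝ) (hC : ∀ z, |S z| ≤ C)
    (hc : ∀ z i x, |S (Function.update z i x) - S z| ≤ c) :
    ∫ z, Real.exp (t * (S z - ∫ z', S z' ∂(Measure.pi fun _ => μ))) ∂(Measure.pi fun _ => μ)
      ≤ Real.exp (n * c ^ 2 * t ^ 2 / 2) := by
  induction n with
  | zero =>
    have : ∀ z : Fin 0 → X, S z = S (fun i => i.elim0) := fun z => by
      congr 1; exact Subsingleton.elim _ _
    simp [this]
  | succ n ih =>
    have hmS : Measurable fun p : X × (Fin n → X) => S (Fin.cons p.1 p.2) :=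
      hS.comp measurable_fin_cons
    -- Averaging out coordinate `0` keeps the mean, the bound `C` and the differences `c`, so the
    -- induction hypothesis applies to `T`.
    set T : (Fin n → X) → ℝ := fun z => ∫ x, S (Fin.cons x z) ∂μ with hT
    have hTm : Measurable T := by
      have : StronglyMeasurable fun z => ∫ x, S (Fin.cons x z) ∂μ :=
        (hmS.stronglyMeasurable).integral_prod_left'
      exact this.measurable
    have hint : ∀ z, Integrable (fun x => S (Fin.cons x z)) μ := fun z =>
      Integrable.of_bound (hmS.comp measurable_prodMk_right).aestronglyMeasurable C
        (Filter.Eventually.of_forall fun x => by simpa using hC _)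
    have hTC : ∀ z, |T z| ≤ C := fun z => by
      have := norm_integral_le_of_norm_le_const (μ := μ) (f := fun x => S (Fin.cons x z)) (C := C)
        (Filter.Eventually.of_forall fun x => by simpa using hC _)
      simpa using this
    have hTc : ∀ z i x, |T (Function.update z i x) - T z| ≤ c := fun z i x => by
      simp only [hT]
      rw [← integral_sub (hint _) (hint _)]
      have := norm_integral_le_of_norm_le_const (μ := μ)
        (f := fun y => S (Fin.cons y (Function.update z i x)) - S (Fin.cons y z)) (C := c)
        (Filter.Eventually.of_forall fun y => by
          have := hc (Fin.cons y z) i.succ x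
          rw [← Fin.cons_update] at this
          simpa using this)
      simpa using this
    have hES : ∫ z, S z ∂(Measure.pi fun _ => μ) = ∫ z, T z ∂(Measure.pi fun _ => μ) :=
      integral_pi_fin_succ μ hS hC
    have hm1 : Measurable fun z : Fin (n + 1) → X =>
        Real.exp (t * (S z - ∫ z', T z' ∂(Measure.pi fun _ => μ))) := by fun_prop
    set m := ∫ z', T z' ∂(Measure.pi fun _ => μ) with hm
    rw [hES, integral_pi_fin_succ μ hm1 (C := Real.exp (|t| * (C + |m|)))]
    swap
    · intro z
      rw [abs_of_pos (Real.exp_pos _)]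
      refine Real.exp_le_exp.2 ((le_abs_self _).trans ?_)
      rw [abs_mul]
      exact mul_le_mul_of_nonneg_left
        ((abs_sub _ _).trans (add_le_add (hC z) le_rfl)) (abs_nonneg _)
    -- Hoeffding's lemma with `z` frozen: the increment `S - T` is centred in `x` and lies in `[-c,
    -- c]`. This interval has length `2c`, hence the variance proxy `c²` per coordinate.
    have hstep : ∀ z : Fin n → X, ∫ x, Real.exp (t * (S (Fin.cons x z) - m)) ∂μ
        ≤ Real.exp (c ^ 2 * t ^ 2 / 2) * Real.exp (t * (T z - m)) := fun z => by
      have h0 : ∀ x y, |S (Fin.cons x z) - S (Fin.cons y z)| ≤ c := fun x y => by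
        have := hc (Fin.cons y z) 0 x
        rwa [Fin.update_cons_zero] at this
      have h1 : ∀ x, |S (Fin.cons x z) - T z| ≤ c := fun x => by
        have e : S (Fin.cons x z) - T z = ∫ y, (S (Fin.cons x z) - S (Fin.cons y z)) ∂μ := by
          rw [integral_sub (integrable_const _) (hint z)]; simp [hT]
        rw [e]
        have := norm_integral_le_of_norm_le_const (μ := μ)
          (f := fun y => S (Fin.cons x z) - S (Fin.cons y z)) (C := c)
          (Filter.Eventually.of_forall fun y => by simpa using h0 x y)
        simpa using this
      have h2 : HasSubgaussianMGF (fun x => S (Fin.cons x z) - T z) ((‖c - -c‖₊ / 2) ^ 2) μ := by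
        refine hasSubgaussianMGF_of_mem_Icc_of_integral_eq_zero
          ((hmS.comp measurable_prodMk_right).sub_const _).aemeasurable
          (Filter.Eventually.of_forall fun x => ?_) ?_
        · exact abs_le.1 (h1 x)
        · rw [integral_sub (hint z) (integrable_const _)]; simp [hT]
      have h3 := h2.mgf_le t
      have h4 : (((‖c - -c‖₊ / 2) ^ 2 : NNReal) : ℝ) = c ^ 2 := by
        push_cast
        rw [Real.norm_eq_abs, div_pow, sq_abs]; ring
      rw [h4, mgf] at h3
      have e : ∀ x, Real.exp (t * (S (Fin.cons x z) - m))
          = Real.exp (t * (S (Fin.cons x z) - T z)) * Real.exp (t * (T z - m)) := fun x => by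
        rw [← Real.exp_add]; ring_nf
      simp_rw [e]
      rw [integral_mul_const]
      exact mul_le_mul_of_nonneg_right h3 (Real.exp_pos _).le
    calc _ ≤ ∫ z, Real.exp (c ^ 2 * t ^ 2 / 2) * Real.exp (t * (T z - m))
          ∂(Measure.pi fun _ : Fin n => μ) := by
          refine integral_mono_of_nonneg
            (Filter.Eventually.of_forall fun z => integral_nonneg fun x => (Real.exp_pos _).le) ?_
            (Filter.Eventually.of_forall hstep)
          refine Integrable.of_bound (C := Real.exp (c ^ 2 * t ^ 2 / 2) *
            Real.exp (|t| * (C + |m|))) (by fun_prop) (Filter.Eventually.of_forall fun z => ?_)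
          rw [Real.norm_eq_abs, abs_of_pos (by positivity)]
          refine mul_le_mul_of_nonneg_left (Real.exp_le_exp.2 ((le_abs_self _).trans ?_))
            (Real.exp_pos _).le
          rw [abs_mul]
          exact mul_le_mul_of_nonneg_left
            ((abs_sub _ _).trans (add_le_add (hTC z) le_rfl)) (abs_nonneg _)
      _ ≤ Real.exp (c ^ 2 * t ^ 2 / 2) * Real.exp (n * c ^ 2 * t ^ 2 / 2) := by
          rw [integral_const_mul]
          exact mul_le_mul_of_nonneg_left (ih T hTm hTC hTc) (Real.exp_pos _).le
      _ = _ := by rw [← Real.exp_add]; push_cast; ring_nf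

/-- The bounded differences inequality (with Azuma's constant). -/
theorem measureReal_pi_ge_le (μ : Measure X) [IsProbabilityMeasure μ] {c : ℝ}
    {n : ℕ} (S : (Fin n → X) → ℝ) (hS : Measurable S) (C : ℝ) (hC : ∀ z, |S z| ≤ C)
    (hc : ∀ z i x, |S (Function.update z i x) - S z| ≤ c) {ε : ℝ} (hε : 0 ≤ ε) :
    (Measure.pi fun _ : Fin n => μ).real
        {z | (∫ z', S z' ∂(Measure.pi fun _ => μ)) + ε ≤ S z}
      ≤ Real.exp (-ε ^ 2 / (2 * (n * c ^ 2))) := by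
  set m := ∫ z', S z' ∂(Measure.pi fun _ => μ) with hm
  have h : HasSubgaussianMGF (fun z => S z - m) (⟨n * c ^ 2, by positivity⟩ : NNReal)
      (Measure.pi fun _ : Fin n => μ) := by
    constructor
    · intro t
      refine Integrable.of_bound (C := Real.exp (|t| * (C + |m|))) (by fun_prop)
        (Filter.Eventually.of_forall fun z => ?_)
      rw [Real.norm_eq_abs, abs_of_pos (by positivity)]
      refine Real.exp_le_exp.2 ((le_abs_self _).trans ?_)
      rw [abs_mul]
      exact mul_le_mul_of_nonneg_left
        ((abs_sub _ _).trans (add_le_add (hC z) le_rfl)) (abs_nonneg _)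
    · intro t
      exact integral_exp_sub_integral_le μ c t n S hS C hC hc
  have := h.measure_ge_le hε
  simp only [le_sub_iff_add_le'] at this
  exact this

end BoundedDifferences

/-! ### Empirical deviations and the almost sure rate -/

section EmpiricalProcess

variable {X : Type*} [MeasurableSpace X]

/-- The deviation of the empirical mean of `f` over a sample `z` from the mean of `f`. -/
noncomputable def empDev (μ : Measure X) {n : ℕ} (z : Fin n → X) (f : X → ℝ) : ℝ :=
  (1 / (n : ℝ)) * ∑ i, f (z i) - ∫ x, f x ∂μ

lemma measurable_empDev (μ : Measure X) {n : ℕ} {f : X → ℝ} (hf : Measurable f) :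
    Measurable fun z : Fin n → X => empDev μ z f := by
  unfold empDev
  fun_prop

lemma abs_mean_le {n : ℕ} {a : Fin n → ℝ} {C : ℝ} (hC : 0 ≤ C) (h : ∀ i, |a i| ≤ C) :
    |(1 / (n : ℝ)) * ∑ i, a i| ≤ C := by
  rcases Nat.eq_zero_or_pos n with rfl | hn
  · simpa using hC
  have hn' : (0 : ℝ) < n := by exact_mod_cast hn
  rw [abs_mul, abs_of_pos (by positivity), one_div, inv_mul_le_iff₀ hn']
  calc |∑ i, a i| ≤ ∑ i, |a i| := Finset.abs_sum_le_sum_abs _ _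
    _ ≤ ∑ _i : Fin n, C := Finset.sum_le_sum fun i _ => h i
    _ = n * C := by simp

lemma abs_empDev_le (μ : Measure X) [IsProbabilityMeasure μ] {n : ℕ} (z : Fin n → X)
    {f : X → ℝ} {C : ℝ} (hC : 0 ≤ C) (hz : ∀ i, |f (z i)| ≤ C) (hf : ∀ᵐ x ∂μ, |f x| ≤ C) :
    |empDev μ z f| ≤ 2 * C := by
  have h1 := abs_mean_le hC hz
  have h2 : |∫ x, f x ∂μ| ≤ C := by
    have := norm_integral_le_of_norm_le_const (μ := μ) (f := f) (C := C) hf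
    simpa using this
  unfold empDev
  exact (abs_sub _ _).trans (by linarith)

lemma empDev_sub (μ : Measure X) {n : ℕ} (z : Fin n → X) {f g : X → ℝ}
    (hf : Integrable f μ) (hg : Integrable g μ) :
    empDev μ z (fun x => f x - g x) = empDev μ z f - empDev μ z g := by
  unfold empDev
  rw [integral_sub hf hg, Finset.sum_sub_distrib]
  ring

lemma empDev_sum (μ : Measure X) {n : ℕ} (z : Fin n → X) {ι : Type*} (s : Finset ι)
    {f : ι → X → ℝ} (a : ι → ℝ) (hf : ∀ i ∈ s, Integrable (f i) μ) :
    empDev μ z (fun x => ∑ i ∈ s, a i * f i x) = ∑ i ∈ s, a i * empDev μ z (f i) := by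
  unfold empDev
  rw [integral_finsetSum _ fun i hi => (hf i hi).const_mul _]
  simp_rw [integral_const_mul, mul_sub, Finset.sum_sub_distrib, Finset.mul_sum]
  rw [Finset.sum_comm]
  congr 1
  refine Finset.sum_congr rfl fun i _ => Finset.sum_congr rfl fun j _ => by ring

/-- Independence makes the variance of the deviation `Var h / n`, and the first absolute moment is
at most the root of the second. The bound scales with the second moment of `h`, not its supremum;
this is the gain for functions supported on small cubes. -/
lemma integral_abs_empDev_le (μ : Measure X) [IsProbabilityMeasure μ] (n : ℕ) {h : X → ℝ}
    (hm : Measurable h) {C : ℝ} (hC : ∀ x, |h x| ≤ C) {v : ℝ} (hv : ∫ x, h x ^ 2 ∂μ ≤ v)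
    (hn : n ≠ 0) :
    ∫ z, |empDev μ z h| ∂(Measure.pi fun _ : Fin n => μ) ≤ √(v / n) := by
  set Q := Measure.pi fun _ : Fin n => μ with hQ
  have hn' : (0 : ℝ) < n := by exact_mod_cast Nat.pos_of_ne_zero hn
  have hC0 : 0 ≤ C := by
    obtain ⟨x⟩ : Nonempty X := nonempty_of_isProbabilityMeasure μ
    exact (abs_nonneg _).trans (hC x)
  have hLp : ∀ i : Fin n, MemLp (fun z : Fin n → X => h (z i)) 2 Q := fun i =>
    MemLp.of_bound (hm.comp (measurable_pi_apply i)).aestronglyMeasurable C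
      (Filter.Eventually.of_forall fun z => hC _)
  have hDm : Measurable fun z : Fin n → X => empDev μ z h := measurable_empDev μ hm
  have hDLp : MemLp (fun z : Fin n → X => empDev μ z h) 2 Q :=
    MemLp.of_bound hDm.aestronglyMeasurable (2 * C) (Filter.Eventually.of_forall fun z =>
      abs_empDev_le μ z hC0 (fun i => hC _) (Filter.Eventually.of_forall hC))
  have hint : ∀ i : Fin n, ∫ z : Fin n → X, h (z i) ∂Q = ∫ x, h x ∂μ := fun i => by
    have e := (measurePreserving_eval (fun _ : Fin n => μ) i).map_eq
    rw [← hQ] at e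
    rw [← e, integral_map (measurable_pi_apply i).aemeasurable (by
      rw [e]; exact hm.aestronglyMeasurable)]
  have hvar1 : ∀ i : Fin n, Var[fun z : Fin n → X => h (z i); Q] = Var[h; μ] := fun i => by
    have e := measurePreserving_eval (fun _ : Fin n => μ) i
    have := variance_map (μ := Q) (Y := fun z : Fin n → X => z i) (X := h)
      hm.aemeasurable (measurable_pi_apply i).aemeasurable
    rw [show Measure.map (fun z : Fin n → X => z i) Q = μ from e.map_eq] at this
    rw [this]; rfl
  have hmean : ∫ z, empDev μ z h ∂Q = 0 := by
    unfold empDev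
    rw [integral_sub, integral_const_mul, integral_finsetSum]
    · simp_rw [hint]
      simp
      field_simp
      simp
    · exact fun i _ => (hLp i).integrable (by norm_num)
    · exact (integrable_finsetSum _ fun i _ => (hLp i).integrable (by norm_num)).const_mul _
    · exact integrable_const _
  have hvar : Var[fun z => empDev μ z h; Q] ≤ v / n := by
    have e1 : Var[fun z => empDev μ z h; Q]
        = (1 / (n : ℝ)) ^ 2 * Var[fun z : Fin n → X => ∑ i, h (z i); Q] := by
      rw [← variance_const_mul]
      unfold empDev
      rw [variance_sub_const]
      exact (Measurable.aestronglyMeasurable (by fun_prop))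
    have e2 : Var[fun z : Fin n → X => ∑ i, h (z i); Q] = n * Var[h; μ] := by
      have := IndepFun.variance_sum (μ := Q) (s := Finset.univ)
        (X := fun (i : Fin n) (z : Fin n → X) => h (z i)) (fun i _ => hLp i)
        (fun i _ j _ hij => (iIndepFun_pi (X := fun (_ : Fin n) => h)
          (fun i => hm.aemeasurable)).indepFun hij)
      rw [show (∑ i, fun z : Fin n → X => h (z i)) = fun z => ∑ i, h (z i) by
        ext z; simp] at this
      rw [this]
      simp [hvar1]
    have e3 : Var[h; μ] ≤ v := (variance_le_expectation_sq hm.aestronglyMeasurable).trans hv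
    rw [e1, e2]
    calc (1 / (n : ℝ)) ^ 2 * (n * Var[h; μ]) = Var[h; μ] / n := by field_simp
      _ ≤ v / n := by gcongr
  have hsq : ∫ z, (empDev μ z h) ^ 2 ∂Q ≤ v / n := by
    have := variance_eq_sub hDLp
    rw [hmean] at this
    simp only [Pi.pow_apply] at this
    linarith
  have habs := variance_nonneg (fun z => |empDev μ z h|) Q
  have hDLp' : MemLp (fun z : Fin n → X => |empDev μ z h|) 2 Q := hDLp.abs
  rw [variance_eq_sub hDLp'] at habs
  simp only [Pi.pow_apply, sq_abs] at habs
  exact Real.le_sqrt_of_sq_le (by linarith)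

/-- Only one summand changes, between two values in an interval of length `M`. The one-sided range
gives `M / n` instead of `2M / n`, on which the constant `√2 M` rests. -/
lemma abs_empDev_update_sub_le (μ : Measure X) {n : ℕ} (z : Fin n → X) (i : Fin n) (x : X)
    {f : X → ℝ} {M : ℝ} (hf : ∀ x, f x ∈ Icc (-M) 0) :
    |empDev μ (Function.update z i x) f - empDev μ z f| ≤ M / n := by
  have hn : (0 : ℝ) < n := by exact_mod_cast i.pos
  have e : empDev μ (Function.update z i x) f - empDev μ z f = (f x - f (z i)) / n := by
    unfold empDev
    have h1 : ∀ j, f (Function.update z i x j) = Function.update (fun j => f (z j)) i (f x) j :=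
      fun j => by
        by_cases h : j = i
        · subst h; simp
        · simp [h]
    simp_rw [h1]
    rw [Finset.sum_update_of_mem (Finset.mem_univ i),
      ← Finset.add_sum_erase Finset.univ (fun j => f (z j)) (Finset.mem_univ i),
      Finset.sdiff_singleton_eq_erase]
    field_simp
    ring
  rw [e, abs_div, abs_of_pos hn]
  gcongr
  rw [abs_le]
  have h1 := hf x
  have h2 := hf (z i)
  constructor <;> linarith [h1.1, h1.2, h2.1, h2.2]

lemma abs_iSup_sub_iSup_le {a b : ℕ → ℝ} (ha : BddAbove (range a)) (hb : BddAbove (range b))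
    {c : ℝ} (h : ∀ i, |a i - b i| ≤ c) : |(⨆ i, a i) - ⨆ i, b i| ≤ c := by
  rw [abs_le]
  constructor
  · have : (⨆ i, b i) ≤ (⨆ i, a i) + c := ciSup_le fun i => by
      have := (abs_le.1 (h i)).1
      linarith [le_ciSup ha i]
    linarith
  · have : (⨆ i, a i) ≤ (⨆ i, b i) + c := ciSup_le fun i => by
      have := (abs_le.1 (h i)).2
      linarith [le_ciSup hb i]
    linarith

/-- The supremum of the absolute deviations over a countable family. -/
noncomputable def supDev (μ : Measure X) (f : ℕ → X → ℝ) {n : ℕ} (z : Fin n → X) : ℝ :=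
  ⨆ i, |empDev μ z (f i)|

variable {μ : Measure X} {f : ℕ → X → ℝ} {M : ℝ}

lemma abs_le_of_mem_Icc_neg {a : ℝ} (h : a ∈ Icc (-M) 0) : |a| ≤ M := by
  rw [abs_le]; exact ⟨h.1, by linarith [h.1, h.2]⟩

lemma abs_empDev_le_of_mem_Icc [IsProbabilityMeasure μ] (hf : ∀ i x, f i x ∈ Icc (-M) 0) {n : ℕ}
    (z : Fin n → X) (i : ℕ) :
    |empDev μ z (f i)| ≤ 2 * M := by
  obtain ⟨x⟩ : Nonempty X := nonempty_of_isProbabilityMeasure μ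
  exact abs_empDev_le μ z ((abs_nonneg _).trans (abs_le_of_mem_Icc_neg (hf i x)))
    (fun j => abs_le_of_mem_Icc_neg (hf i _))
    (Filter.Eventually.of_forall fun x => abs_le_of_mem_Icc_neg (hf i x))

lemma bddAbove_abs_empDev [IsProbabilityMeasure μ] (hf : ∀ i x, f i x ∈ Icc (-M) 0) {n : ℕ}
    (z : Fin n → X) :
    BddAbove (range fun i => |empDev μ z (f i)|) :=
  ⟨2 * M, by rintro _ ⟨i, rfl⟩; exact abs_empDev_le_of_mem_Icc hf z i⟩

lemma supDev_nonneg {n : ℕ} (z : Fin n → X) : 0 ≤ supDev μ f z :=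
  Real.iSup_nonneg fun _ => abs_nonneg _

lemma supDev_le [IsProbabilityMeasure μ] (hf : ∀ i x, f i x ∈ Icc (-M) 0) {n : ℕ} (z : Fin n → X) :
    supDev μ f z ≤ 2 * M := ciSup_le fun i => abs_empDev_le_of_mem_Icc hf z i

lemma measurable_supDev (hm : ∀ i, Measurable (f i)) {n : ℕ} :
    Measurable fun z : Fin n → X => supDev μ f z :=
  Measurable.iSup fun i => (measurable_empDev μ (hm i)).abs

/-- If the expected supremum of the deviations over a countable family of functions with values in
`[-M, 0]` is of order `1 / √n`, then almost surely the supremum is eventually smaller than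
`τ √(log n / n)`, for every `τ > √2 M`. -/
theorem ae_eventually_supDev_lt (hM : 0 < M) (hm : ∀ i, Measurable (f i))
    (hf : ∀ i x, f i x ∈ Icc (-M) 0) {C : ℝ}
    (hC : ∀ n : ℕ, n ≠ 0 → ∫ z, supDev μ f z ∂(Measure.pi fun _ : Fin n => μ) ≤ C / √n)
    {Ω : Type*} [MeasurableSpace Ω] (P : Measure Ω) [IsProbabilityMeasure P]
    {Z : ℕ → Ω → X} (hZ : ∀ i, Measurable (Z i)) (hlaw : ∀ i, P.map (Z i) = μ)
    (hindep : iIndepFun Z P) {τ : ℝ} (hτ : √2 * M < τ) :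
    ∀ᵐ ω ∂P, ∀ᶠ n : ℕ in Filter.atTop,
      supDev μ f (fun i : Fin n => Z i ω) < τ * √(Real.log n / n) := by
  have : IsProbabilityMeasure μ := hlaw 0 ▸ Measure.isProbabilityMeasure_map (hZ 0).aemeasurable
  -- The midpoint leaves room on both sides: `τ' > √2 M` makes the exponent `p` exceed `1`, and `τ -
  -- τ' > 0` absorbs the mean `C / √n`.
  set τ' := (√2 * M + τ) / 2 with hτ'
  have h1 : √2 * M < τ' := by rw [hτ']; linarith
  have h2 : τ' < τ := by rw [hτ']; linarith
  have hτ'0 : 0 < τ' := lt_of_le_of_lt (by positivity) h1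
  set p := τ' ^ 2 / (2 * M ^ 2) with hp
  have hp1 : 1 < p := by
    rw [hp, one_lt_div (by positivity)]
    calc 2 * M ^ 2 = (√2 * M) ^ 2 := by rw [mul_pow, Real.sq_sqrt (by norm_num)]
      _ < τ' ^ 2 := by gcongr
  -- The shift `n = k + 1` avoids the sample size `0`, where the bound on the mean is not available.
  let s : ℕ → Set Ω := fun k => {ω | C / √((k + 1 : ℕ) : ℝ)
    + τ' * √(Real.log ((k + 1 : ℕ) : ℝ) / ((k + 1 : ℕ) : ℝ))
      ≤ supDev μ f (fun i : Fin (k + 1) => Z i ω)}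
  have hs : ∀ k, P (s k) ≤ ENNReal.ofReal (((k + 1 : ℕ) : ℝ) ^ (-p)) := by
    intro k
    set n := k + 1 with hn
    have hn0 : (0 : ℝ) < n := by rw [hn]; positivity
    have hlog : 0 ≤ Real.log n := Real.log_natCast_nonneg n
    have hmap : P.map (fun ω (i : Fin n) => Z i ω) = Measure.pi fun _ : Fin n => μ := by
      rw [iIndepFun.map_fun_eq_pi_map (f := fun (i : Fin n) ω => Z i ω)
        (fun i => (hZ i).aemeasurable) (hindep.precomp Fin.val_injective)]
      simp_rw [hlaw]
    have hzm : Measurable fun ω (i : Fin n) => Z i ω := measurable_pi_iff.2 fun i => hZ i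
    set ε := τ' * √(Real.log n / n) with hε
    have hε0 : 0 ≤ ε := by positivity
    have hbd := measureReal_pi_ge_le μ (c := M / n) (n := n) (supDev μ f)
      (measurable_supDev hm) (2 * M)
      (fun z => by rw [abs_of_nonneg (supDev_nonneg z)]; exact supDev_le hf z)
      (fun z i x => abs_iSup_sub_iSup_le (bddAbove_abs_empDev hf _) (bddAbove_abs_empDev hf _)
        fun j => (abs_abs_sub_abs_le _ _).trans
          (abs_empDev_update_sub_le μ z i x (hf j))) hε0
    have hexp : Real.exp (-ε ^ 2 / (2 * (n * (M / n) ^ 2))) = (n : ℝ) ^ (-p) := by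
      rw [Real.rpow_def_of_pos hn0, hε, mul_pow, Real.sq_sqrt (by positivity), hp]
      congr 1
      field_simp
    rw [hexp] at hbd
    set m := ∫ z', supDev μ f z' ∂(Measure.pi fun _ : Fin n => μ) with hmean
    have hms : MeasurableSet {z : Fin n → X |
        m + ε ≤ supDev μ f z} :=
      measurableSet_le measurable_const (measurable_supDev hm)
    calc P (s k) ≤ P ((fun ω (i : Fin n) => Z i ω) ⁻¹' {z : Fin n → X |
          m + ε ≤ supDev μ f z}) := by
          refine measure_mono fun ω hω => ?_
          have h3 := hC n (by omega)
          have h4 : C / √(n : ℝ) + ε ≤ supDev μ f (fun i : Fin n => Z i ω) := hω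
          show _ + ε ≤ _
          linarith
      _ = (Measure.pi fun _ : Fin n => μ) {z : Fin n → X |
          m + ε ≤ supDev μ f z} := by
          rw [← Measure.map_apply hzm hms, hmap]
      _ ≤ _ := by
          rw [← ENNReal.ofReal_toReal (measure_ne_top _ _)]
          exact ENNReal.ofReal_le_ofReal hbd
  have hsum : ∑' k, P (s k) ≠ ∞ := by
    have hsm : Summable fun k : ℕ => (((k + 1 : ℕ) : ℝ) ^ (-p)) :=
      (summable_nat_add_iff 1).2 (Real.summable_nat_rpow.2 (by linarith))
    refine ne_top_of_le_ne_top ?_ (ENNReal.tsum_le_tsum hs)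
    rw [← ENNReal.ofReal_tsum_of_nonneg (fun k => by positivity) hsm]
    exact ENNReal.ofReal_ne_top
  -- Multiplying by `(τ - τ') / √n`, this says that `C / √n` is below `(τ - τ') √(log n / n)`.
  have hlogtop : ∀ᶠ n : ℕ in Filter.atTop, C / (τ - τ') < √(Real.log n) :=
    (Real.tendsto_sqrt_atTop.comp
      (Real.tendsto_log_atTop.comp tendsto_natCast_atTop_atTop)).eventually_gt_atTop _
  filter_upwards [ae_eventually_notMem hsum] with ω hω
  obtain ⟨N, hN⟩ := Filter.eventually_atTop.1 hω
  filter_upwards [hlogtop, Filter.eventually_ge_atTop (N + 1)] with n hn1 hn2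
  obtain ⟨k, rfl⟩ : ∃ k, n = k + 1 := ⟨n - 1, by omega⟩
  have h3 := hN k (by omega)
  simp only [s, mem_ofPred_eq, not_le] at h3
  refine h3.trans ?_
  have hn0 : (0 : ℝ) < ((k + 1 : ℕ) : ℝ) := by positivity
  have h4 : C / √((k + 1 : ℕ) : ℝ)
      < (τ - τ') * √(Real.log ((k + 1 : ℕ) : ℝ) / ((k + 1 : ℕ) : ℝ)) := by
    rw [Real.sqrt_div' _ hn0.le, ← mul_div_assoc]
    have : 0 < √((k + 1 : ℕ) : ℝ) := Real.sqrt_pos.2 hn0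
    gcongr
    rwa [div_lt_iff₀' (by linarith)] at hn1
  linarith

end EmpiricalProcess

/-! ### Geometry and measure of the cube -/

section Cube

variable {d : ℕ}

lemma cube_eq_preimage (d : ℕ) :
    cube d = (EuclideanSpace.equiv (Fin d) ℝ).toHomeomorph ⁻¹' (Set.pi univ fun _ => Icc 0 1) := by
  ext x; simp only [cube, mem_preimage, mem_univ_pi]; rfl

lemma interior_cube (d : ℕ) : interior (cube d) = {x | ∀ i, x i ∈ Ioo (0 : ℝ) 1} := by
  rw [cube_eq_preimage, ← Homeomorph.preimage_interior, interior_pi_set finite_univ]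
  ext x
  simp only [interior_Icc, mem_preimage, mem_univ_pi]
  rfl

lemma mem_interior_cube {x : E d} : x ∈ interior (cube d) ↔ ∀ i, x i ∈ Ioo (0 : ℝ) 1 := by
  rw [interior_cube]; rfl

lemma isCompact_cube (d : ℕ) : IsCompact (cube d) := by
  rw [cube_eq_preimage, Homeomorph.isCompact_preimage]
  exact isCompact_univ_pi fun _ => isCompact_Icc

lemma measurableSet_cube (d : ℕ) : MeasurableSet (cube d) := (isCompact_cube d).measurableSet

lemma convex_cube (d : ℕ) : Convex ℝ (cube d) := by
  intro x hx y hy a b ha hb hab i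
  have := (convex_Icc (0 : ℝ) 1) (hx i) (hy i) ha hb hab
  simpa using this

lemma convex_interior_cube (d : ℕ) : Convex ℝ (interior (cube d)) := (convex_cube d).interior

lemma interior_cube_nonempty (d : ℕ) : (interior (cube d)).Nonempty :=
  ⟨WithLp.toLp 2 fun _ => 1 / 2, mem_interior_cube.2 fun i => by simp; norm_num⟩

lemma closure_interior_cube (d : ℕ) : closure (interior (cube d)) = cube d := by
  rw [(convex_cube d).closure_interior_eq_closure_of_nonempty_interior (interior_cube_nonempty d),
    (isCompact_cube d).isClosed.closure_eq]

lemma volume_box (a b : Fin d → ℝ) :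
    volume {x : E d | ∀ i, x i ∈ Ico (a i) (b i)} = ∏ i, ENNReal.ofReal (b i - a i) := by
  have e : {x : E d | ∀ i, x i ∈ Ico (a i) (b i)}
      = (MeasurableEquiv.toLp 2 (Fin d → ℝ)).symm ⁻¹' (Set.pi univ fun i => Ico (a i) (b i)) := by
    ext x; simp only [mem_preimage, mem_univ_pi]; rfl
  rw [e, (EuclideanSpace.volume_preserving_symm_measurableEquiv_toLp (Fin d)).measure_preimage_equiv,
    Real.volume_pi_Ico]

lemma volume_cube (d : ℕ) : volume (cube d) = 1 := by
  have e : cube d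
      = (MeasurableEquiv.toLp 2 (Fin d → ℝ)).symm ⁻¹' (Set.pi univ fun i => Icc 0 1) := by
    ext x; simp only [cube, mem_preimage, mem_univ_pi]; rfl
  rw [e, (EuclideanSpace.volume_preserving_symm_measurableEquiv_toLp (Fin d)).measure_preimage_equiv,
    volume_pi_pi]
  simp

instance (d : ℕ) : IsProbabilityMeasure (noiseMeasure d) :=
  ⟨by rw [noiseMeasure, Measure.restrict_apply_univ, volume_cube]⟩

/-- The frontier of a convex set is null. Derivative bounds hold only in the interior, so samples
must avoid the boundary. -/
lemma ae_mem_interior_cube (d : ℕ) : ∀ᵐ x ∂(noiseMeasure d), x ∈ interior (cube d) := by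
  rw [noiseMeasure, ae_restrict_iff' (measurableSet_cube d)]
  have h : volume (frontier (cube d)) = 0 := (convex_cube d).addHaar_frontier volume
  filter_upwards [compl_mem_ae_iff.2 h] with x hx hxc
  by_contra hxi
  exact hx ⟨subset_closure hxc, hxi⟩

end Cube

/-! ### Polynomials and Taylor approximation -/

section Polynomials

variable {d : ℕ}

/-- The coordinate functions on `ℝ^d`. -/
noncomputable def coordMap (i : Fin d) : C(E d, ℝ) := ⟨fun x => x i, by fun_prop⟩

/-- The polynomial functions on `ℝ^d` of degree less than `l`. -/
noncomputable def polySpace (d : ℕ) : ℕ → Submodule ℝ C(E d, ℝ)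
  | 0 => ⊥
  | l + 1 => Submodule.span ℝ {1} ⊔
      ⨆ i : Fin d, (polySpace d l).map (LinearMap.mulLeft ℝ (coordMap i))

instance (l : ℕ) : FiniteDimensional ℝ (polySpace d l) := by
  induction l with
  | zero => exact Module.Finite.bot ℝ _
  | succ l ih =>
    have (i : Fin d) : FiniteDimensional ℝ
        ((polySpace d l).map (LinearMap.mulLeft ℝ (coordMap i))) := Module.Finite.map _ _
    exact Submodule.finite_sup _ _

lemma one_mem_polySpace (l : ℕ) : (1 : C(E d, ℝ)) ∈ polySpace d (l + 1) :=
  Submodule.mem_sup_left (Submodule.mem_span_singleton_self _)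

lemma coordMap_mul_mem_polySpace {l : ℕ} (i : Fin d) {p : C(E d, ℝ)} (hp : p ∈ polySpace d l) :
    coordMap i * p ∈ polySpace d (l + 1) :=
  Submodule.mem_sup_right (Submodule.mem_iSup_of_mem i ⟨p, hp, rfl⟩)

lemma polySpace_le_succ (l : ℕ) : polySpace d l ≤ polySpace d (l + 1) := by
  induction l with
  | zero => simp [polySpace]
  | succ l ih => exact sup_le_sup_left (iSup_mono fun i => Submodule.map_mono ih) _

lemma polySpace_mono : Monotone (polySpace d) := monotone_nat_of_le_succ polySpace_le_succ

/-- Substitution turns a factor `x i` into `r * x i + v i`, which raises the degree by at most one.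
This lets polynomials be rescaled from a dyadic cube to the unit cube. -/
lemma comp_affine_mem_polySpace (r : ℝ) (v : E d) (a : C(E d, E d)) (ha : ∀ x, a x = r • x + v)
    (l : ℕ) : ∀ p ∈ polySpace d l, p.comp a ∈ polySpace d l := by
  induction l with
  | zero =>
    intro p hp
    have : p = 0 := by simpa [polySpace] using hp
    subst this
    exact Submodule.zero_mem _
  | succ l ih =>
    change polySpace d (l + 1) ≤
      (polySpace d (l + 1)).comap (ContinuousMap.compRightAlgHom ℝ ℝ a).toLinearMap
    conv_lhs => rw [polySpace]
    refine sup_le ?_ (iSup_le fun i => ?_)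
    · rw [Submodule.span_singleton_le_iff_mem]
      exact one_mem_polySpace l
    · rintro _ ⟨p, hp, rfl⟩
      have e : (coordMap i * p).comp a = r • (coordMap i * p.comp a) + v i • p.comp a := by
        ext x
        simp only [coordMap, ContinuousMap.comp_apply, ContinuousMap.mul_apply, ha,
          ContinuousMap.coe_mk, ContinuousMap.add_apply, ContinuousMap.smul_apply, smul_eq_mul,
          PiLp.add_apply, PiLp.smul_apply]
        ring
      change (coordMap i * p).comp a ∈ polySpace d (l + 1)
      rw [e]
      exact Submodule.add_mem _ (Submodule.smul_mem _ _ (coordMap_mul_mem_polySpace i (ih p hp)))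
        (Submodule.smul_mem _ _ (polySpace_le_succ l (ih p hp)))

/-- Expanding the first argument in the standard basis splits off one coordinate factor and leaves a
form of one degree less. Taylor terms are of this kind. -/
lemma diagonal_mem_polySpace (l : ℕ) :
    ∀ (M : ContinuousMultilinearMap ℝ (fun _ : Fin l => E d) ℝ) (q : C(E d, ℝ)),
      (∀ y, q y = M fun _ => y) → q ∈ polySpace d (l + 1) := by
  induction l with
  | zero =>
    intro M q hq
    have : q = (M fun i => i.elim0) • (1 : C(E d, ℝ)) := by
      ext y
      simp only [hq, ContinuousMap.smul_apply, ContinuousMap.one_apply, smul_eq_mul, mul_one]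
      congr 1; exact Subsingleton.elim _ _
    rw [this]
    exact Submodule.smul_mem _ _ (one_mem_polySpace 0)
  | succ l ih =>
    intro M q hq
    have e : q = ∑ i, coordMap i * (⟨fun y => M.curryLeft (EuclideanSpace.single i 1) fun _ => y,
        by fun_prop⟩ : C(E d, ℝ)) := by
      ext y
      have hy : y = ∑ i, y i • EuclideanSpace.single i (1 : ℝ) := by
        simpa using ((EuclideanSpace.basisFun (Fin d) ℝ).sum_repr y).symm
      have h1 : M (fun _ => y) = M.curryLeft y fun _ => y := by
        rw [ContinuousMultilinearMap.curryLeft_apply]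
        congr 1
        ext j : 1
        refine Fin.cases ?_ (fun j => ?_) j <;> simp
      rw [hq, h1]
      have h2 : M.curryLeft y = ∑ i, y i • M.curryLeft (EuclideanSpace.single i 1) := by
        conv_lhs => rw [hy]
        rw [map_sum]
        simp_rw [map_smul]
      rw [h2]
      simp only [coordMap, ContinuousMap.sum_apply, ContinuousMap.mul_apply, ContinuousMap.coe_mk,
        sum_apply, smul_apply, smul_eq_mul]
    rw [e]
    exact Submodule.sum_mem _ fun i _ => coordMap_mul_mem_polySpace i
      (ih (M.curryLeft (EuclideanSpace.single i 1)) _ fun y => rfl)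

/-- Taylor's formula with integral remainder along the segment from `c` to `x`, which convexity
keeps in `U`; the factors `1 / n!` and `(1 - t) ^ n` are bounded by `1`. -/
lemma exists_polySpace_approx {n : ℕ} {U : Set (E d)} (hU : IsOpen U) (hconv : Convex ℝ U)
    {f : E d → ℝ} (hf : ContDiffOn ℝ (n + 1 : ℕ) f U) {A : ℝ}
    (hA : ∀ x ∈ U, ‖iteratedFDeriv ℝ (n + 1) f x‖ ≤ A) {c : E d} (hc : c ∈ U) :
    ∃ p ∈ polySpace d (n + 1), ∀ x ∈ U, |f x - p x| ≤ A * ‖x - c‖ ^ (n + 1) := by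
  let q : ℕ → C(E d, ℝ) := fun k => ⟨fun y => iteratedFDeriv ℝ k f c fun _ => y, by fun_prop⟩
  let a : C(E d, E d) := ⟨fun x => (1 : ℝ) • x + -c, by fun_prop⟩
  refine ⟨∑ k ∈ Finset.range (n + 1), ((k.factorial : ℝ)⁻¹) • (q k).comp a, ?_, fun x hx => ?_⟩
  · refine Submodule.sum_mem _ fun k hk => Submodule.smul_mem _ _ ?_
    have hk' : k + 1 ≤ n + 1 := by simpa using Finset.mem_range.1 hk
    exact polySpace_mono hk' (comp_affine_mem_polySpace 1 (-c) a (fun x => rfl) _ _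
      (diagonal_mem_polySpace k (iteratedFDeriv ℝ k f c) _ fun y => rfl))
  · have hseg : ∀ t ∈ Icc (0 : ℝ) 1, c + t • (x - c) ∈ U := fun t ht =>
      hconv.add_smul_sub_mem hc hx ht
    have htay := map_add_eq_sum_add_integral_iteratedFDeriv (f := f) (x := c) (y := x - c) (n := n)
      (fun t ht => by exact_mod_cast hf.contDiffAt (hU.mem_nhds (hseg t ht)))
    rw [add_sub_cancel] at htay
    have hp : (∑ k ∈ Finset.range (n + 1), ((k.factorial : ℝ)⁻¹) • (q k).comp a : C(E d, ℝ)) x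
        = ∑ k ∈ Finset.range (n + 1),
          ((k.factorial : ℝ)⁻¹) • (iteratedFDeriv ℝ k f c fun _ => x - c) := by
      simp [ContinuousMap.sum_apply, q, a, sub_eq_add_neg]
    rw [hp, htay, add_sub_cancel_left, smul_eq_mul, abs_mul]
    have hA0 : 0 ≤ A := (norm_nonneg _).trans (hA c hc)
    have h1 : |((n.factorial : ℝ)⁻¹)| ≤ 1 := by
      rw [abs_of_nonneg (by positivity)]
      exact inv_le_one_of_one_le₀ (by exact_mod_cast n.factorial_pos)
    have h2 := intervalIntegral.norm_integral_le_of_norm_le_const (a := (0 : ℝ)) (b := 1)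
      (f := fun t => (1 - t) ^ n • iteratedFDeriv ℝ (n + 1) f (c + t • (x - c)) fun _ => x - c)
      (C := A * ‖x - c‖ ^ (n + 1)) (fun t ht => by
        rw [uIoc_of_le zero_le_one] at ht
        rw [norm_smul]
        have h3 : ‖(1 - t) ^ n‖ ≤ 1 := by
          rw [norm_pow]
          refine pow_le_one₀ (norm_nonneg _) ?_
          rw [Real.norm_eq_abs, abs_le]; constructor <;> linarith [ht.1, ht.2]
        have h4 := (iteratedFDeriv ℝ (n + 1) f (c + t • (x - c))).le_opNorm fun _ => x - c
        simp only [Finset.prod_const, Finset.card_univ, Fintype.card_fin] at h4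
        have h5 : ‖iteratedFDeriv ℝ (n + 1) f (c + t • (x - c))‖ ≤ A :=
          hA _ (hseg t ⟨ht.1.le, ht.2⟩)
        calc _ ≤ 1 * (A * ‖x - c‖ ^ (n + 1)) :=
              mul_le_mul h3 (h4.trans (by gcongr)) (norm_nonneg _) zero_le_one
          _ = _ := one_mul _)
    simp only [sub_zero, abs_one, mul_one, Real.norm_eq_abs] at h2
    calc _ ≤ 1 * (A * ‖x - c‖ ^ (n + 1)) := mul_le_mul h1 h2 (abs_nonneg _) zero_le_one
      _ = _ := one_mul _

lemma exists_coord_bound {F : Type*} [NormedAddCommGroup F] [NormedSpace ℝ F] {N : ℕ}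
    (W : Submodule ℝ F) [FiniteDimensional ℝ W] (B : Module.Basis (Fin N) ℝ W) :
    ∃ C : ℝ, 0 < C ∧ ∀ v i, |B.equivFun v i| ≤ C * ‖(v : F)‖ := by
  let φ : W →L[ℝ] (Fin N → ℝ) := LinearMap.toContinuousLinearMap B.equivFun.toLinearMap
  refine ⟨‖φ‖ + 1, by positivity, fun v i => ?_⟩
  calc |φ v i| ≤ ‖φ v‖ := norm_le_pi_norm (φ v) i
    _ ≤ ‖φ‖ * ‖v‖ := φ.le_opNorm v
    _ ≤ (‖φ‖ + 1) * ‖(v : F)‖ := by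
      rw [Submodule.coe_norm]; gcongr; linarith

/-- On the unit cube, a small polynomial is a combination with small coefficients of finitely many
fixed functions. -/
lemma exists_polySpace_basis (d m : ℕ) : ∃ (N : ℕ) (b : Fin N → C(E d, ℝ)) (C : ℝ), 0 < C ∧
    ∀ p ∈ polySpace d m, ∀ ε : ℝ, (∀ x ∈ interior (cube d), |p x| ≤ ε) →
      ∃ a : Fin N → ℝ, (∀ i, |a i| ≤ C * ε) ∧ ∀ x ∈ cube d, p x = ∑ i, a i * b i x := by
  have : CompactSpace (cube d) := isCompact_iff_compactSpace.1 (isCompact_cube d)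
  let res : C(E d, ℝ) →ₗ[ℝ] C(cube d, ℝ) :=
    (ContinuousMap.compRightAlgHom ℝ ℝ
      (⟨Subtype.val, continuous_subtype_val⟩ : C(cube d, E d))).toLinearMap
  -- On restrictions to the cube the supremum over the cube is a norm, and in finite dimension it
  -- controls the coordinates in a basis. The basis vectors are then lifted back to functions on the
  -- whole space.
  let W := (polySpace d m).map res
  let B := Module.finBasis ℝ W
  have hB : ∀ i, ∃ b : C(E d, ℝ), res b = B i := fun i => by
    obtain ⟨b, -, hb⟩ := (B i).2
    exact ⟨b, hb⟩
  choose b hb using hB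
  obtain ⟨C, hC0, hC⟩ := exists_coord_bound W B
  refine ⟨_, b, C, hC0, fun p hp ε hε => ?_⟩
  have hε0 : 0 ≤ ε := by
    obtain ⟨x, hx⟩ := interior_cube_nonempty d
    exact (abs_nonneg _).trans (hε x hx)
  let w : W := ⟨res p, p, hp, rfl⟩
  have hw : ‖w‖ ≤ ε := by
    change ‖res p‖ ≤ ε
    rw [ContinuousMap.norm_le _ hε0]
    rintro ⟨x, hx⟩
    rw [← closure_interior_cube] at hx
    exact le_on_closure (f := fun x => |p x|) (g := fun _ => ε) hε (by fun_prop) (by fun_prop) hx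
  refine ⟨B.equivFun w, fun i => ?_, fun x hx => ?_⟩
  · exact (hC w i).trans (mul_le_mul_of_nonneg_left hw hC0.le)
  · have h1 := B.sum_equivFun w
    have h2 := congrArg (fun u : W => (u : C(cube d, ℝ)) ⟨x, hx⟩) h1
    simp only [Submodule.coe_sum, Submodule.coe_smul, ContinuousMap.sum_apply,
      ContinuousMap.smul_apply, smul_eq_mul, ← hb] at h2
    exact h2.symm

end Polynomials

/-! ### Dyadic cubes and functions supported on them -/

section Cells

variable {d : ℕ}

/-- The half-open dyadic cube of side `2⁻ʲ` with corner `2⁻ʲ q`. -/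
def cell (j : ℕ) (q : Fin d → ℕ) : Set (E d) :=
  {x | ∀ i, x i ∈ Ico ((q i : ℝ) / 2 ^ j) (((q i : ℝ) + 1) / 2 ^ j)}

/-- The indices of the dyadic cubes of side `2⁻ʲ` in the unit cube. -/
def cellIndices (d j : ℕ) : Finset (Fin d → ℕ) := Fintype.piFinset fun _ => Finset.range (2 ^ j)

/-- The affine map taking `[0,1)^d` to the dyadic cube `cell j q`. -/
noncomputable def cellParam (j : ℕ) (q : Fin d → ℕ) : C(E d, E d) :=
  ⟨fun y => ((1 / 2 : ℝ) ^ j) • y + WithLp.toLp 2 fun i => (q i : ℝ) / 2 ^ j, by fun_prop⟩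

/-- The inverse of `cellParam`. -/
noncomputable def cellCoord (j : ℕ) (q : Fin d → ℕ) (x : E d) : E d :=
  WithLp.toLp 2 fun i => 2 ^ j * x i - q i

lemma cellParam_apply (j : ℕ) (q : Fin d → ℕ) (y : E d) (i : Fin d) :
    cellParam j q y i = (y i + q i) / 2 ^ j := by
  simp [cellParam]; ring

lemma cellParam_cellCoord (j : ℕ) (q : Fin d → ℕ) (x : E d) :
    cellParam j q (cellCoord j q x) = x := by
  ext i
  rw [cellParam_apply]
  simp [cellCoord]

lemma mem_cell {j : ℕ} {q : Fin d → ℕ} {x : E d} :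
    x ∈ cell j q ↔ ∀ i, (q i : ℝ) ≤ 2 ^ j * x i ∧ 2 ^ j * x i < q i + 1 := by
  have h : (0 : ℝ) < 2 ^ j := by positivity
  simp only [cell, mem_ofPred_eq, mem_Ico, div_le_iff₀' h, lt_div_iff₀' h]

lemma mem_cellIndices {j : ℕ} {q : Fin d → ℕ} : q ∈ cellIndices d j ↔ ∀ i, q i < 2 ^ j := by
  simp [cellIndices]

lemma card_cellIndices (d j : ℕ) : (cellIndices d j).card = (2 ^ j) ^ d := by
  simp [cellIndices, Fintype.card_piFinset]

/-- The index of the dyadic cube of side `2⁻ʲ` containing `x`. -/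
noncomputable def cellIndex (j : ℕ) (x : E d) : Fin d → ℕ := fun i => ⌊2 ^ j * x i⌋₊

lemma mem_cell_iff_cellIndex_eq {j : ℕ} {q : Fin d → ℕ} {x : E d} (hx : x ∈ interior (cube d)) :
    x ∈ cell j q ↔ cellIndex j x = q := by
  rw [mem_cell, funext_iff]
  refine forall_congr' fun i => ?_
  have h := (mem_interior_cube.1 hx i).1
  exact (Nat.floor_eq_iff (by positivity)).symm

lemma cellIndex_mem {j : ℕ} {x : E d} (hx : x ∈ interior (cube d)) :
    cellIndex j x ∈ cellIndices d j := by
  refine mem_cellIndices.2 fun i => ?_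
  have h := mem_interior_cube.1 hx i
  refine (Nat.floor_lt (by have := h.1; positivity)).2 ?_
  push_cast
  have : (0 : ℝ) < 2 ^ j := by positivity
  nlinarith [h.2]

lemma mem_cell_parent {j : ℕ} {q : Fin d → ℕ} {x : E d} (hx : x ∈ cell (j + 1) q) :
    x ∈ cell j (fun i => q i / 2) := by
  rw [mem_cell] at hx ⊢
  intro i
  obtain ⟨h1, h2⟩ := hx i
  have h3 : ((2 * (q i / 2) : ℕ) : ℝ) ≤ q i := by exact_mod_cast Nat.mul_div_le _ _
  have h4 : (q i : ℝ) ≤ ((2 * (q i / 2) + 1 : ℕ) : ℝ) := by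
    have : q i ≤ 2 * (q i / 2) + 1 := by omega
    exact_mod_cast this
  push_cast at h3 h4 ⊢
  rw [pow_succ] at h1 h2
  constructor <;> linarith

lemma parent_mem_cellIndices {j : ℕ} {q : Fin d → ℕ} (hq : q ∈ cellIndices d (j + 1)) :
    (fun i => q i / 2) ∈ cellIndices d j := by
  rw [mem_cellIndices] at hq ⊢
  intro i
  have := hq i
  rw [pow_succ] at this
  show q i / 2 < 2 ^ j
  omega

lemma cellCoord_mem_cube {j : ℕ} {q : Fin d → ℕ} {x : E d} (hx : x ∈ cell j q) :
    cellCoord j q x ∈ cube d := fun i => by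
  obtain ⟨h1, h2⟩ := mem_cell.1 hx i
  simp only [cellCoord, mem_Icc]
  constructor <;> linarith

lemma cellParam_mem {j : ℕ} {q : Fin d → ℕ} (hq : q ∈ cellIndices d j) {y : E d}
    (hy : y ∈ interior (cube d)) : cellParam j q y ∈ interior (cube d) ∩ cell j q := by
  have hj : (0 : ℝ) < 2 ^ j := by positivity
  rw [mem_interior_cube] at hy
  refine ⟨mem_interior_cube.2 fun i => ?_, mem_cell.2 fun i => ?_⟩
  · have h1 : (q i : ℝ) + 1 ≤ 2 ^ j := by exact_mod_cast mem_cellIndices.1 hq i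
    have h2 : (0 : ℝ) ≤ q i := Nat.cast_nonneg _
    rw [cellParam_apply]
    refine ⟨div_pos (by linarith [(hy i).1]) hj, (div_lt_one hj).2 (by linarith [(hy i).2])⟩
  · rw [cellParam_apply, mul_div_cancel₀ _ hj.ne']
    constructor <;> linarith [(hy i).1, (hy i).2]

lemma measurableSet_cell (j : ℕ) (q : Fin d → ℕ) : MeasurableSet (cell j q) := by
  have : cell j q = ⋂ i, (fun x : E d => x i) ⁻¹'
      Ico ((q i : ℝ) / 2 ^ j) (((q i : ℝ) + 1) / 2 ^ j) := by
    ext x; simp [cell]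
  rw [this]
  exact MeasurableSet.iInter fun i => measurableSet_Ico.preimage (by fun_prop)

lemma noiseMeasure_cell_le (j : ℕ) (q : Fin d → ℕ) :
    (noiseMeasure d).real (cell j q) ≤ ((1 / 2 : ℝ) ^ j) ^ d := by
  have h1 : noiseMeasure d (cell j q) ≤ ENNReal.ofReal (((1 / 2 : ℝ) ^ j) ^ d) := by
    refine (Measure.restrict_apply_le _ _).trans ?_
    rw [cell, volume_box]
    have : ∀ i, ((q i : ℝ) + 1) / 2 ^ j - (q i : ℝ) / 2 ^ j = (1 / 2) ^ j := fun i => by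
      rw [div_pow, one_pow]; ring
    simp_rw [this]
    rw [Finset.prod_const, Finset.card_univ, Fintype.card_fin, ← ENNReal.ofReal_pow (by positivity)]
  exact ENNReal.toReal_le_of_le_ofReal (by positivity) h1

/-- The function `b`, transported from the unit cube to a dyadic cube and extended by zero. -/
noncomputable def cellFun (j : ℕ) (q : Fin d → ℕ) (b : C(E d, ℝ)) : E d → ℝ :=
  (cell j q).indicator fun x => b (cellCoord j q x)

lemma measurable_cellFun (j : ℕ) (q : Fin d → ℕ) (b : C(E d, ℝ)) : Measurable (cellFun j q b) := by
  refine Measurable.indicator ?_ (measurableSet_cell j q)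
  refine Continuous.measurable (b.continuous.comp ?_)
  unfold cellCoord
  fun_prop

lemma abs_cellFun_le {j : ℕ} {q : Fin d → ℕ} {b : C(E d, ℝ)} {D : ℝ} (hD : 0 ≤ D)
    (hb : ∀ x ∈ cube d, |b x| ≤ D) (x : E d) : |cellFun j q b x| ≤ D := by
  unfold cellFun
  by_cases hx : x ∈ cell j q
  · rw [indicator_of_mem hx]; exact hb _ (cellCoord_mem_cube hx)
  · rw [indicator_of_notMem hx]; simpa using hD

/-- The second moment carries the volume of the cell; its square root supplies the factor
`2^(-jd/2)` in the sum over scales. -/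
lemma integral_cellFun_sq_le {j : ℕ} {q : Fin d → ℕ} {b : C(E d, ℝ)} {D : ℝ} (hD : 0 ≤ D)
    (hb : ∀ x ∈ cube d, |b x| ≤ D) :
    ∫ x, cellFun j q b x ^ 2 ∂(noiseMeasure d) ≤ D ^ 2 * ((1 / 2 : ℝ) ^ j) ^ d := by
  calc ∫ x, cellFun j q b x ^ 2 ∂(noiseMeasure d)
      ≤ ∫ x, (cell j q).indicator (fun _ => D ^ 2) x ∂(noiseMeasure d) := by
        refine integral_mono_of_nonneg (Filter.Eventually.of_forall fun x => sq_nonneg _)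
          ((integrable_const _).indicator (measurableSet_cell j q))
          (Filter.Eventually.of_forall fun x => ?_)
        by_cases hx : x ∈ cell j q
        · simp only [indicator_of_mem hx]
          rw [← sq_abs]
          gcongr
          exact abs_cellFun_le hD hb x
        · simp [cellFun, hx]
    _ = D ^ 2 * (noiseMeasure d).real (cell j q) := by
        rw [integral_indicator_const _ (measurableSet_cell j q), smul_eq_mul, mul_comm]
    _ ≤ _ := by gcongr; exact noiseMeasure_cell_le j q

end Cells

/-! ### The dyadic multiscale decomposition -/

section Chaining

variable {d : ℕ}

/-- Functions on the open unit cube with a bound on the function and its derivatives of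
order `n + 1`. -/
structure SmoothBound (n : ℕ) (A : ℝ) (f : E d → ℝ) : Prop where
  contDiffOn : ContDiffOn ℝ (n + 1 : ℕ) f (interior (cube d))
  abs_le : ∀ x ∈ interior (cube d), |f x| ≤ A
  norm_le : ∀ x ∈ interior (cube d), ‖iteratedFDeriv ℝ (n + 1) f x‖ ≤ A

lemma SmoothBound.nonneg {n : ℕ} {A : ℝ} {f : E d → ℝ} (hf : SmoothBound n A f) : 0 ≤ A := by
  obtain ⟨x, hx⟩ := interior_cube_nonempty d
  exact (abs_nonneg _).trans (hf.abs_le x hx)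

/-- Taylor expansion at the centre of the cell, all of whose points are within `(d + 1) 2⁻ʲ`. At
scale `0` the approximant is `0`, justified by `|f| ≤ A`, so that telescoping over scales starts
from zero. -/
lemma SmoothBound.exists_cell_approx {n : ℕ} {A : ℝ} {f : E d → ℝ} (hf : SmoothBound n A f)
    (j : ℕ) (q : Fin d → ℕ) (hq : q ∈ cellIndices d j) :
    ∃ p ∈ polySpace d (n + 1), (j = 0 → p = 0) ∧ ∀ x ∈ interior (cube d) ∩ cell j q,
      |f x - p x| ≤ (d + 1) ^ (n + 1) * A * ((1 / 2 : ℝ) ^ (n + 1)) ^ j := by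
  have hA := hf.nonneg
  rcases Nat.eq_zero_or_pos j with rfl | hj
  · refine ⟨0, Submodule.zero_mem _, fun _ => rfl, fun x hx => ?_⟩
    simp only [ContinuousMap.zero_apply, sub_zero, pow_zero, mul_one]
    have : (1 : ℝ) ≤ (d + 1) ^ (n + 1) := one_le_pow₀ (by linarith [Nat.cast_nonneg (α := ℝ) d])
    nlinarith [hf.abs_le x hx.1]
  set c : E d := cellParam j q (WithLp.toLp 2 fun _ => 1 / 2) with hc
  have hcU : c ∈ interior (cube d) :=
    (cellParam_mem hq (mem_interior_cube.2 fun i => by simp; norm_num)).1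
  obtain ⟨p, hp, hpx⟩ := exists_polySpace_approx isOpen_interior (convex_interior_cube d)
    hf.contDiffOn hf.norm_le hcU
  refine ⟨p, hp, fun h => by omega, fun x hx => (hpx x hx.1).trans ?_⟩
  have hj0 : (0 : ℝ) < 2 ^ j := by positivity
  have hdist : ‖x - c‖ ≤ (d + 1) * (1 / 2) ^ j := by
    rw [EuclideanSpace.norm_eq]
    refine Real.sqrt_le_iff.2 ⟨by positivity, ?_⟩
    have hi : ∀ i, ‖(x - c) i‖ ^ 2 ≤ ((1 / 2 : ℝ) ^ j) ^ 2 := fun i => by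
      have h1 := mem_cell.1 hx.2 i
      have h2 : c i = (1 / 2 + q i) / 2 ^ j := by rw [hc, cellParam_apply]
      refine pow_le_pow_left₀ (norm_nonneg _) ?_ 2
      rw [PiLp.sub_apply, h2, Real.norm_eq_abs, _root_.abs_le, one_div, inv_pow]
      have h3 : x i - (1 / 2 + q i) / 2 ^ j = (2 ^ j * x i - q i - 1 / 2) * (2 ^ j)⁻¹ := by
        field_simp; ring
      rw [one_div] at h3
      rw [h3]
      have h4 : (0 : ℝ) < (2 ^ j)⁻¹ := by positivity
      constructor <;> nlinarith [h1.1, h1.2]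
    calc ∑ i, ‖(x - c) i‖ ^ 2 ≤ ∑ _i : Fin d, ((1 / 2 : ℝ) ^ j) ^ 2 :=
          Finset.sum_le_sum fun i _ => hi i
      _ = d * ((1 / 2 : ℝ) ^ j) ^ 2 := by simp
      _ ≤ ((d + 1) * (1 / 2) ^ j) ^ 2 := by
        rw [mul_pow]
        gcongr
        nlinarith [Nat.cast_nonneg (α := ℝ) d]
  calc A * ‖x - c‖ ^ (n + 1) ≤ A * ((d + 1) * (1 / 2) ^ j) ^ (n + 1) := by gcongr
    _ = _ := by rw [mul_pow, ← pow_mul, ← pow_mul, mul_comm j]; ring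

/-- The dyadic multiscale decomposition: a smooth function on the cube is a sum over dyadic scales
of combinations of finitely many fixed functions on each dyadic cube, with geometrically decaying
coefficients. -/
theorem exists_dyadic_decomposition (d n : ℕ) :
    ∃ (N : ℕ) (b : Fin N → C(E d, ℝ)) (C : ℝ), 0 < C ∧
      ∀ (A : ℝ) (f : E d → ℝ), SmoothBound n A f →
        ∃ a : ℕ → (Fin d → ℕ) → Fin N → ℝ,
          (∀ j, ∀ q ∈ cellIndices d (j + 1), ∀ i,
            |a j q i| ≤ C * A * ((1 / 2 : ℝ) ^ (n + 1)) ^ j) ∧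
          ∀ J, ∀ x ∈ interior (cube d),
            |f x - ∑ j ∈ Finset.range J, ∑ q ∈ cellIndices d (j + 1), ∑ i,
              a j q i * cellFun (j + 1) q (b i) x| ≤ C * A * ((1 / 2 : ℝ) ^ (n + 1)) ^ J := by
  obtain ⟨N, b, C₀, hC₀, hb⟩ := exists_polySpace_basis d (n + 1)
  set C₁ : ℝ := (d + 1) ^ (n + 1) with hC₁
  have hC₁0 : 0 < C₁ := by positivity
  set ρ : ℝ := (1 / 2 : ℝ) ^ (n + 1) with hρ
  have hρ0 : 0 < ρ := by positivity
  have hρ1 : ρ ≤ 1 := pow_le_one₀ (by norm_num) (by norm_num)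
  -- The first summand serves the coefficients of the increments, the second the remainder at scale
  -- `J`.
  refine ⟨N, b, C₀ * (2 * C₁) + C₁, by positivity, fun A f hf => ?_⟩
  have hA := hf.nonneg
  choose! p hp hp0 hpx using hf.exists_cell_approx
  -- On a cell, its polynomial and that of its parent both approximate `f`, so they differ by at
  -- most `2 C₁ A ρ ^ j`. The difference is again a polynomial; pulled back to the unit cube it has
  -- small coefficients in the fixed basis.
  have hinc : ∀ j, ∀ q ∈ cellIndices d (j + 1), ∃ a : Fin N → ℝ,
      (∀ i, |a i| ≤ C₀ * (2 * C₁ * A * ρ ^ j)) ∧ ∀ x ∈ cell (j + 1) q,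
        p (j + 1) q x - p j (fun i => q i / 2) x = ∑ i, a i * b i (cellCoord (j + 1) q x) := by
    intro j q hq
    have hq' := parent_mem_cellIndices hq
    obtain ⟨a, ha, hax⟩ := hb ((p (j + 1) q - p j fun i => q i / 2).comp (cellParam (j + 1) q))
      (comp_affine_mem_polySpace _ _ _ (fun x => rfl) _ _
        (Submodule.sub_mem _ (hp _ _ hq) (hp _ _ hq'))) (2 * C₁ * A * ρ ^ j) (fun y hy => by
          have hy' := cellParam_mem hq hy
          set x := cellParam (j + 1) q y with hx
          have h1 := hpx _ _ hq x hy'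
          have h2 := hpx _ _ hq' x ⟨hy'.1, mem_cell_parent hy'.2⟩
          have h3 : C₁ * A * ρ ^ (j + 1) ≤ C₁ * A * ρ ^ j :=
            mul_le_mul_of_nonneg_left (pow_le_pow_of_le_one hρ0.le hρ1 (Nat.le_succ j))
              (by positivity)
          rw [ContinuousMap.comp_apply, ← hx, ContinuousMap.sub_apply]
          rw [abs_le] at h1 h2 ⊢
          constructor <;> linarith [h1.1, h1.2, h2.1, h2.2])
    refine ⟨a, ha, fun x hx => ?_⟩
    have := hax _ (cellCoord_mem_cube hx)
    rwa [ContinuousMap.comp_apply, cellParam_cellCoord] at this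
  choose! a ha hax using hinc
  refine ⟨a, fun j q hq i => (ha j q hq i).trans ?_, fun J x hx => ?_⟩
  · have : 0 ≤ C₁ * A * ρ ^ j := by positivity
    nlinarith
  · have hstep : ∀ j, ∑ q ∈ cellIndices d (j + 1), ∑ i, a j q i * cellFun (j + 1) q (b i) x
        = p (j + 1) (cellIndex (j + 1) x) x - p j (cellIndex j x) x := by
      intro j
      have hmem := (mem_cell_iff_cellIndex_eq (j := j + 1) hx).2 rfl
      have hpar : cellIndex j x = fun i => cellIndex (j + 1) x i / 2 :=
        (mem_cell_iff_cellIndex_eq hx).1 (mem_cell_parent hmem)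
      rw [Finset.sum_eq_single_of_mem _ (cellIndex_mem hx)]
      · rw [hpar, hax j _ (cellIndex_mem hx) x hmem]
        simp only [cellFun, indicator_of_mem hmem]
      · intro q _ hq
        refine Finset.sum_eq_zero fun i _ => ?_
        have : x ∉ cell (j + 1) q := fun h => hq ((mem_cell_iff_cellIndex_eq hx).1 h).symm
        simp [cellFun, this]
    simp_rw [hstep]
    rw [Finset.sum_range_sub (fun j => p j (cellIndex j x) x), hp0 0 _ (cellIndex_mem hx) rfl,
      ContinuousMap.zero_apply, sub_zero]
    refine (hpx J _ (cellIndex_mem hx) x ⟨hx, (mem_cell_iff_cellIndex_eq hx).2 rfl⟩).trans ?_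
    have : 0 ≤ C₀ * (2 * C₁) * (A * ρ ^ J) := by positivity
    nlinarith

end Chaining

/-! ### The expected supremum of the deviations -/

section Expectation

variable {d : ℕ}

lemma integrable_cellFun {j : ℕ} {q : Fin d → ℕ} (b : C(E d, ℝ)) :
    Integrable (cellFun j q b) (noiseMeasure d) := by
  obtain ⟨D, hD⟩ := (isCompact_cube d).exists_bound_of_continuousOn b.continuous.continuousOn
  refine Integrable.of_bound (measurable_cellFun j q b).aestronglyMeasurable (max D 0)
    (Filter.Eventually.of_forall fun x => ?_)
  exact abs_cellFun_le (le_max_right _ _) (fun y hy => (hD y hy).trans (le_max_left _ _)) x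

/-- The deviation is linear in the function. The right side depends on `f` only through `c`, hence
bounds the supremum over a whole class before any expectation is taken. -/
lemma abs_empDev_le_of_decomposition {m : ℕ} {z : Fin m → E d} (hz : ∀ i, z i ∈ interior (cube d))
    {f : E d → ℝ} (hf : Integrable f (noiseMeasure d)) {N : ℕ} (b : Fin N → C(E d, ℝ))
    {a : ℕ → (Fin d → ℕ) → Fin N → ℝ} {c : ℝ} {ρ : ℝ} {J : ℕ}
    (ha : ∀ j, ∀ q ∈ cellIndices d (j + 1), ∀ i, |a j q i| ≤ c * ρ ^ j)
    (hfa : ∀ x ∈ interior (cube d), |f x - ∑ j ∈ Finset.range J, ∑ q ∈ cellIndices d (j + 1), ∑ i,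
      a j q i * cellFun (j + 1) q (b i) x| ≤ c * ρ ^ J) :
    |empDev (noiseMeasure d) z f| ≤ (∑ j ∈ Finset.range J, ∑ q ∈ cellIndices d (j + 1), ∑ i,
      c * ρ ^ j * |empDev (noiseMeasure d) z (cellFun (j + 1) q (b i))|) + 2 * (c * ρ ^ J) := by
  set μ := noiseMeasure d with hμ
  let s : Finset (Σ _ : ℕ, Σ _ : Fin d → ℕ, Fin N) :=
    (Finset.range J).sigma fun j => (cellIndices d (j + 1)).sigma fun _ => Finset.univ
  let a' : (Σ _ : ℕ, Σ _ : Fin d → ℕ, Fin N) → ℝ := fun k => a k.1 k.2.1 k.2.2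
  let h' : (Σ _ : ℕ, Σ _ : Fin d → ℕ, Fin N) → E d → ℝ :=
    fun k => cellFun (k.1 + 1) k.2.1 (b k.2.2)
  have hs : ∀ g : ℕ → (Fin d → ℕ) → Fin N → ℝ,
      ∑ j ∈ Finset.range J, ∑ q ∈ cellIndices d (j + 1), ∑ i, g j q i
        = ∑ k ∈ s, g k.1 k.2.1 k.2.2 := fun g => by
    simp only [s, Finset.sum_sigma]
  set T : E d → ℝ := fun x => ∑ k ∈ s, a' k * h' k x with hT
  have hTint : Integrable T μ :=
    integrable_finsetSum _ fun k _ => (integrable_cellFun _).const_mul _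
  have hfT : ∀ x ∈ interior (cube d), |f x - T x| ≤ c * ρ ^ J := fun x hx => by
    have := hfa x hx
    rwa [hs fun j q i => a j q i * cellFun (j + 1) q (b i) x] at this
  have hc0 : 0 ≤ c * ρ ^ J := by
    obtain ⟨x, hx⟩ := interior_cube_nonempty d
    exact (abs_nonneg _).trans (hfT x hx)
  have h1 : |empDev μ z (fun x => f x - T x)| ≤ 2 * (c * ρ ^ J) :=
    abs_empDev_le μ z hc0 (fun i => hfT _ (hz i)) (by
      filter_upwards [ae_mem_interior_cube d] with x hx using hfT x hx)
  rw [empDev_sub μ z hf hTint] at h1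
  have h2 : empDev μ z T = ∑ k ∈ s, a' k * empDev μ z (h' k) :=
    empDev_sum μ z s a' fun k _ => integrable_cellFun _
  have h3 : |empDev μ z T| ≤ ∑ k ∈ s, c * ρ ^ k.1 * |empDev μ z (h' k)| := by
    rw [h2]
    refine (Finset.abs_sum_le_sum_abs _ _).trans (Finset.sum_le_sum fun k hk => ?_)
    rw [abs_mul]
    simp only [s, Finset.mem_sigma] at hk
    exact mul_le_mul_of_nonneg_right (ha _ _ hk.2.1 _) (abs_nonneg _)
  rw [hs fun j q i => c * ρ ^ j * |empDev μ z (cellFun (j + 1) q (b i))|]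
  have h4 : |empDev μ z f| ≤ |empDev μ z T| + |empDev μ z f - empDev μ z T| := by
    have := abs_add_le (empDev μ z T) (empDev μ z f - empDev μ z T)
    rwa [add_sub_cancel] at this
  linarith

/-- The maximal inequality: for classes of functions with more than `d / 2` bounded derivatives,
the expected supremum of the deviations is of order `1 / √m` in the sample size `m`. -/
theorem exists_integral_supDev_le {n : ℕ} (hn : d < 2 * (n + 1)) (A M : ℝ) :
    ∃ C : ℝ, ∀ f : ℕ → E d → ℝ, (∀ k, Measurable (f k)) → (∀ k x, f k x ∈ Icc (-M) 0) →
      (∀ k, SmoothBound n A (f k)) → ∀ m : ℕ, m ≠ 0 →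
        ∫ z, supDev (noiseMeasure d) f z ∂(Measure.pi fun _ : Fin m => noiseMeasure d)
          ≤ C / √m := by
  obtain ⟨N, b, C, hC, hdec⟩ := exists_dyadic_decomposition d n
  have hD : ∃ D : ℝ, 0 ≤ D ∧ ∀ i, ∀ x ∈ cube d, |b i x| ≤ D := by
    have h1 : ∀ i, ∃ D : ℝ, ∀ x ∈ cube d, |b i x| ≤ D := fun i =>
      (isCompact_cube d).exists_bound_of_continuousOn (b i).continuous.continuousOn
    choose D hD using h1
    refine ⟨∑ i, |D i|, Finset.sum_nonneg fun i _ => abs_nonneg _, fun i x hx => ?_⟩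
    exact ((hD i x hx).trans (le_abs_self _)).trans
      (Finset.single_le_sum (f := fun i => |D i|) (fun i _ => abs_nonneg _) (Finset.mem_univ i))
  obtain ⟨D, hD0, hD⟩ := hD
  set ρ : ℝ := (1 / 2 : ℝ) ^ (n + 1) with hρ
  have hρ0 : 0 < ρ := by positivity
  have hρ1 : ρ < 1 := pow_lt_one₀ (by norm_num) (by norm_num) (by omega)
  set σ : ℝ := √(2 ^ d) with hσ
  have hσ0 : 0 < σ := by positivity
  -- The hypothesis `d < 2 * (n + 1)` enters here: the decay `2^(-(n+1))` of the coefficients beats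
  -- the growth `2^(d/2)`.
  have hθ1 : ρ * σ < 1 := by
    have h1 : (ρ * σ) ^ 2 < 1 := by
      rw [mul_pow, hσ, Real.sq_sqrt (by positivity), hρ, ← pow_mul, one_div, inv_pow,
        inv_mul_lt_iff₀ (by positivity), mul_one]
      exact pow_lt_pow_right₀ (by norm_num) (by omega)
    exact (sq_lt_one_iff₀ (by positivity)).1 h1
  refine ⟨C * A * N * D * σ * (1 - ρ * σ)⁻¹, fun f hfm hfM hfs m hm => ?_⟩
  have hA : 0 ≤ A := (hfs 0).nonneg
  have hm0 : (0 : ℝ) < m := by exact_mod_cast Nat.pos_of_ne_zero hm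
  set μ := noiseMeasure d with hμ
  set Q := Measure.pi fun _ : Fin m => μ with hQ
  have hfint : ∀ k, Integrable (f k) μ := fun k =>
    Integrable.of_bound (hfm k).aestronglyMeasurable M
      (Filter.Eventually.of_forall fun x => abs_le_of_mem_Icc_neg (hfM k x))
  have hae : ∀ᵐ z ∂Q, ∀ i, z i ∈ interior (cube d) := by
    rw [ae_all_iff]
    exact fun i => (measurePreserving_eval (fun _ : Fin m => μ) i).quasiMeasurePreserving.ae
      (ae_mem_interior_cube d)
  have hdevint : ∀ j q i, Integrable (fun z => |empDev μ z (cellFun j q (b i))|) Q :=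
    fun j q i => Integrable.of_bound
      (measurable_empDev μ (measurable_cellFun j q (b i))).abs.aestronglyMeasurable (2 * D)
      (Filter.Eventually.of_forall fun z => by
        rw [Real.norm_eq_abs, abs_abs]
        exact abs_empDev_le μ z hD0 (fun i' => abs_cellFun_le hD0 (hD i) _)
          (Filter.Eventually.of_forall fun x => abs_cellFun_le hD0 (hD i) _))
  have hsupint : Integrable (fun z => supDev μ f z) Q :=
    Integrable.of_bound (measurable_supDev hfm).aestronglyMeasurable (2 * M)
      (Filter.Eventually.of_forall fun z => by
        rw [Real.norm_eq_abs, abs_of_nonneg (supDev_nonneg z)]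
        exact supDev_le hfM z)
  have hdev : ∀ j q i, ∫ z, |empDev μ z (cellFun j q (b i))| ∂Q
      ≤ D * √(((1 / 2 : ℝ) ^ j) ^ d) / √m := fun j q i => by
    have := integral_abs_empDev_le μ m (measurable_cellFun j q (b i))
      (abs_cellFun_le hD0 (hD i)) (integral_cellFun_sq_le hD0 (hD i)) hm
    rwa [Real.sqrt_div' _ hm0.le, Real.sqrt_mul (by positivity), Real.sqrt_sq hD0] at this
  -- Number of cells times the standard deviation per cell: `2^(jd) · 2^(-jd/2) = σ ^ j`.
  have hscale : ∀ j : ℕ, (((2 ^ j) ^ d : ℕ) : ℝ) * √(((1 / 2 : ℝ) ^ j) ^ d) = σ ^ j := fun j => by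
    have e0 : (σ ^ j) ^ 2 = (2 ^ j) ^ d := by
      have hσ2 : σ ^ 2 = 2 ^ d := Real.sq_sqrt (by positivity)
      rw [pow_right_comm, hσ2, pow_right_comm]
    have e1 : ((1 / 2 : ℝ) ^ j) ^ d = ((σ ^ j)⁻¹) ^ 2 := by
      rw [inv_pow, e0, one_div, inv_pow, inv_pow]
    have e2 : (((2 ^ j) ^ d : ℕ) : ℝ) = (σ ^ j) ^ 2 := by
      rw [e0]; push_cast; rfl
    rw [e1, Real.sqrt_sq (by positivity), e2]
    field_simp
  have hJ : ∀ J : ℕ, ∫ z, supDev μ f z ∂Q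
      ≤ C * A * N * D * σ * (1 - ρ * σ)⁻¹ / √m + 2 * (C * A * ρ ^ J) := by
    intro J
    have hpt : ∀ᵐ z ∂Q, supDev μ f z ≤ (∑ j ∈ Finset.range J, ∑ q ∈ cellIndices d (j + 1), ∑ i,
        C * A * ρ ^ j * |empDev μ z (cellFun (j + 1) q (b i))|) + 2 * (C * A * ρ ^ J) := by
      filter_upwards [hae] with z hz
      refine ciSup_le fun k => ?_
      obtain ⟨a, ha, hfa⟩ := hdec A (f k) (hfs k)
      exact abs_empDev_le_of_decomposition hz (hfint k) b ha (hfa J)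
    have hint1 : ∀ j q i, Integrable
        (fun z => C * A * ρ ^ j * |empDev μ z (cellFun (j + 1) q (b i))|) Q :=
      fun j q i => (hdevint _ _ _).const_mul _
    have hint2 : ∀ j, Integrable (fun z => ∑ q ∈ cellIndices d (j + 1), ∑ i,
        C * A * ρ ^ j * |empDev μ z (cellFun (j + 1) q (b i))|) Q := fun j =>
      integrable_finsetSum _ fun q _ => integrable_finsetSum _ fun i _ => hint1 j q i
    have hlevel : ∀ j, ∫ z, (∑ q ∈ cellIndices d (j + 1), ∑ i,
        C * A * ρ ^ j * |empDev μ z (cellFun (j + 1) q (b i))|) ∂Q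
          ≤ C * A * N * D * σ / √m * (ρ * σ) ^ j := by
      intro j
      rw [integral_finsetSum _ fun q _ => integrable_finsetSum _ fun i _ => hint1 j q i]
      calc ∑ q ∈ cellIndices d (j + 1), ∫ z, (∑ i,
              C * A * ρ ^ j * |empDev μ z (cellFun (j + 1) q (b i))|) ∂Q
          ≤ ∑ _q ∈ cellIndices d (j + 1),
              N * (C * A * ρ ^ j * (D * √(((1 / 2 : ℝ) ^ (j + 1)) ^ d) / √m)) := by
            refine Finset.sum_le_sum fun q _ => ?_
            rw [integral_finsetSum _ fun i _ => hint1 j q i]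
            simp_rw [integral_const_mul]
            calc _ ≤ ∑ _i : Fin N, C * A * ρ ^ j * (D * √(((1 / 2 : ℝ) ^ (j + 1)) ^ d) / √m) :=
                  Finset.sum_le_sum fun i _ =>
                    mul_le_mul_of_nonneg_left (hdev (j + 1) q i) (by positivity)
              _ = _ := by simp
        _ = C * A * N * D / √m * ρ ^ j *
              ((((2 ^ (j + 1)) ^ d : ℕ) : ℝ) * √(((1 / 2 : ℝ) ^ (j + 1)) ^ d)) := by
            rw [Finset.sum_const, card_cellIndices, nsmul_eq_mul]
            ring
        _ = _ := by rw [hscale, mul_pow, pow_succ]; ring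
    calc ∫ z, supDev μ f z ∂Q
        ≤ ∫ z, ((∑ j ∈ Finset.range J, ∑ q ∈ cellIndices d (j + 1), ∑ i,
          C * A * ρ ^ j * |empDev μ z (cellFun (j + 1) q (b i))|) + 2 * (C * A * ρ ^ J)) ∂Q :=
          integral_mono_ae hsupint
            ((integrable_finsetSum _ fun j _ => hint2 j).add (integrable_const _)) hpt
      _ = (∑ j ∈ Finset.range J, ∫ z, (∑ q ∈ cellIndices d (j + 1), ∑ i,
          C * A * ρ ^ j * |empDev μ z (cellFun (j + 1) q (b i))|) ∂Q) + 2 * (C * A * ρ ^ J) := by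
          rw [integral_add (integrable_finsetSum _ fun j _ => hint2 j) (integrable_const _),
            integral_finsetSum _ fun j _ => hint2 j]
          simp
      _ ≤ (∑ j ∈ Finset.range J, C * A * N * D * σ / √m * (ρ * σ) ^ j) + 2 * (C * A * ρ ^ J) := by
          gcongr with j _
          exact hlevel j
      _ ≤ _ := by
          rw [← Finset.mul_sum]
          have hgeo : ∑ j ∈ Finset.range J, (ρ * σ) ^ j ≤ (1 - ρ * σ)⁻¹ := by
            rw [← tsum_geometric_of_lt_one (by positivity) hθ1]
            exact (summable_geometric_of_lt_one (by positivity) hθ1).sum_le_tsum _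
              fun j _ => by positivity
          have : C * A * N * D * σ / √m * ∑ j ∈ Finset.range J, (ρ * σ) ^ j
              ≤ C * A * N * D * σ / √m * (1 - ρ * σ)⁻¹ := by gcongr
          calc _ ≤ C * A * N * D * σ / √m * (1 - ρ * σ)⁻¹ + 2 * (C * A * ρ ^ J) := by gcongr
            _ = _ := by ring
  -- The sample size is fixed while `J → ∞`, which removes the remainder.
  have hlim : Filter.Tendsto (fun J : ℕ => C * A * N * D * σ * (1 - ρ * σ)⁻¹ / √m
      + 2 * (C * A * ρ ^ J)) Filter.atTop
      (𝓝 (C * A * N * D * σ * (1 - ρ * σ)⁻¹ / √m + 2 * (C * A * 0))) :=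
    tendsto_const_nhds.add
      (((tendsto_pow_atTop_nhds_zero_of_lt_one hρ0.le hρ1).const_mul _).const_mul _)
  simpa using ge_of_tendsto' hlim hJ

end Expectation

/-! ### Symmetry of higher derivatives -/

section Symmetry

/-- Swapping the last two arguments is Schwarz's theorem for `D²f`, differentiated `n` further
times; any other adjacent swap leaves the last argument alone and follows by induction applied to
`fderiv ℝ f`. -/
lemma iteratedFDeriv_comp_swap {V : Type} [NormedAddCommGroup V] [NormedSpace ℝ V] (n : ℕ) :
    ∀ {F : Type} [NormedAddCommGroup F] [NormedSpace ℝ F] {f : V → F} {x : V},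
      ContDiffAt ℝ (n + 1 : ℕ) f x → ∀ (w : Fin (n + 1) → V) (i : Fin n),
        iteratedFDeriv ℝ (n + 1) f x (w ∘ Equiv.swap i.castSucc i.succ)
          = iteratedFDeriv ℝ (n + 1) f x w := by
  induction n with
  | zero => intro F _ _ f x _ w i; exact i.elim0
  | succ n ih =>
    intro F _ _ f x hf w i
    have hf1 : ContDiffAt ℝ (n + 1 : ℕ) (fderiv ℝ f) x := hf.fderiv_right (by norm_cast)
    refine Fin.lastCases ?_ (fun j => ?_) i
    -- Near `x` the second derivative is fixed by the flip `L`. Being continuous and linear, `L`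
    -- commutes with iterated derivatives, so those of `D²f` have flip-invariant values.
    · let L : (V →L[ℝ] V →L[ℝ] F) →L[ℝ] (V →L[ℝ] V →L[ℝ] F) :=
        (ContinuousLinearMap.flipₗᵢ ℝ V V F).toContinuousLinearEquiv.toContinuousLinearMap
      have hf2 : ContDiffAt ℝ (n : ℕ) (fderiv ℝ (fderiv ℝ f)) x := hf1.fderiv_right (by norm_cast)
      have hsymm : ∀ᶠ y in 𝓝 x, fderiv ℝ (fderiv ℝ f) y
          = (L ∘ fderiv ℝ (fderiv ℝ f)) y := by
        filter_upwards [hf.eventually (by simp)] with y hy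
        have h2 : IsSymmSndFDerivAt ℝ f y := hy.isSymmSndFDerivAt (by
          rw [minSmoothness_of_isRCLikeNormedField]
          exact_mod_cast Nat.le_add_left 2 n)
        ext v v'
        exact h2 v v'
      have key : ∀ u : Fin n → V, ∀ v v', iteratedFDeriv ℝ n (fderiv ℝ (fderiv ℝ f)) x u v v'
          = iteratedFDeriv ℝ n (fderiv ℝ (fderiv ℝ f)) x u v' v := by
        intro u v v'
        have e1 := (Filter.EventuallyEq.iteratedFDeriv ℝ hsymm n).self_of_nhds
        have e2 := ContinuousLinearMap.iteratedFDeriv_comp_left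
          (G := V →L[ℝ] V →L[ℝ] F) L hf2 le_rfl
        have e3 := e1.trans e2
        have e4 := congrArg (fun M => M u v v') e3
        exact e4
      have hsw : ∀ w : Fin (n + 2) → V, iteratedFDeriv ℝ (n + 2) f x w
          = iteratedFDeriv ℝ n (fderiv ℝ (fderiv ℝ f)) x (Fin.init (Fin.init w))
            (w (Fin.last n).castSucc) (w (Fin.last (n + 1))) := fun w => by
        rw [iteratedFDeriv_succ_apply_right, iteratedFDeriv_succ_apply_right]
        rfl
      rw [hsw, hsw, key]
      have h1 : (w ∘ Equiv.swap (Fin.last n).castSucc (Fin.last n).succ) (Fin.last (n + 1))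
          = w (Fin.last n).castSucc := by
        simp [← Fin.succ_last]
      have h2 : (w ∘ Equiv.swap (Fin.last n).castSucc (Fin.last n).succ) (Fin.last n).castSucc
          = w (Fin.last (n + 1)) := by
        simp
      have h3 : Fin.init (Fin.init (w ∘ Equiv.swap (Fin.last n).castSucc (Fin.last n).succ))
          = Fin.init (Fin.init w) := by
        ext t : 1
        simp only [Fin.init, Function.comp_apply]
        rw [Equiv.swap_apply_of_ne_of_ne]
        · intro h; have := congrArg Fin.val h; simp at this; omega
        · intro h; have := congrArg Fin.val h; simp at this; omega
      rw [h1, h2, h3]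
    · rw [iteratedFDeriv_succ_apply_right (w ∘ _), iteratedFDeriv_succ_apply_right w]
      have h1 : (w ∘ Equiv.swap j.castSucc.castSucc j.castSucc.succ) (Fin.last (n + 1))
          = w (Fin.last (n + 1)) := by
        simp only [Function.comp_apply]
        rw [Equiv.swap_apply_of_ne_of_ne]
        · intro h; have := congrArg Fin.val h; simp at this; omega
        · intro h; have := congrArg Fin.val h; simp at this; omega
      have h2 : Fin.init (w ∘ Equiv.swap j.castSucc.castSucc j.castSucc.succ)
          = Fin.init w ∘ Equiv.swap j.castSucc j.succ := by
        ext t : 1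
        simp only [Fin.init, Function.comp_apply]
        rw [Fin.succ_castSucc, ← (Fin.castSucc_injective _).swap_apply]
      rw [h1, h2]
      exact congrArg (fun L : V →L[ℝ] F => L (w (Fin.last (n + 1)))) (ih hf1 (Fin.init w) j)

/-- The iterated derivative of a `C^n` function is symmetric. -/
theorem iteratedFDeriv_comp_perm_of_contDiffAt {V F : Type} [NormedAddCommGroup V]
    [NormedSpace ℝ V] [NormedAddCommGroup F] [NormedSpace ℝ F] {n : ℕ} {f : V → F} {x : V}
    (hf : ContDiffAt ℝ n f x) (w : Fin n → V) (σ : Equiv.Perm (Fin n)) :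
    iteratedFDeriv ℝ n f x (w ∘ σ) = iteratedFDeriv ℝ n f x w := by
  cases n with
  | zero => congr 1; exact Subsingleton.elim _ _
  | succ n =>
    have hσ : σ ∈ Submonoid.closure
        (Set.range fun i : Fin n => Equiv.swap i.castSucc i.succ) := by
      rw [Equiv.Perm.mclosure_swap_castSucc_succ]; trivial
    induction hσ using Submonoid.closure_induction generalizing w with
    | mem τ hτ =>
      obtain ⟨i, rfl⟩ := hτ
      exact iteratedFDeriv_comp_swap n hf w i
    | one => rfl
    | mul σ τ _ _ hσ hτ =>
      rw [Equiv.Perm.coe_mul, ← Function.comp_assoc, hτ, hσ]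

lemma iteratedFDeriv_comp_equiv {V F : Type} [NormedAddCommGroup V]
    [NormedSpace ℝ V] [NormedAddCommGroup F] [NormedSpace ℝ F] {n n' : ℕ} (h : n' = n)
    {f : V → F} {x : V} (hf : ContDiffAt ℝ n f x) (w : Fin n' → V) (e : Fin n ≃ Fin n') :
    iteratedFDeriv ℝ n f x (w ∘ e) = iteratedFDeriv ℝ n' f x w := by
  subst h
  exact iteratedFDeriv_comp_perm_of_contDiffAt hf w e

end Symmetry

/-! ### From partial derivatives to operator norms -/

section DerivativeBounds

variable {d : ℕ} {F : Type} [NormedAddCommGroup F] [NormedSpace ℝ F]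

/-- `multiDeriv` evaluates at basis vectors listed in increasing order. Here `β` counts occurrences
in `v`, the equivalence `e` sorts the list, and symmetry makes the order irrelevant. -/
lemma exists_multiDeriv_eq {l : ℕ} (v : Fin l → Fin d) : ∃ β : Fin d → ℕ, ∑ i, β i = l ∧
    ∀ {f : E d → F} {x : E d}, ContDiffAt ℝ l f x →
      iteratedFDeriv ℝ l f x (fun t => EuclideanSpace.single (v t) (1 : ℝ)) = multiDeriv β f x := by
  let β : Fin d → ℕ := fun i => Fintype.card {t // v t = i}
  let e : Fin l ≃ Fin (∑ i, β i) :=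
    (Equiv.sigmaFiberEquiv v).symm.trans
      ((Equiv.sigmaCongrRight fun i => Fintype.equivFin {t // v t = i}).trans finSigmaFinEquiv)
  have he : ∑ i, β i = l := by simpa using (Fintype.card_congr e).symm
  refine ⟨β, he, fun {f x} hf => ?_⟩
  rw [multiDeriv, ← iteratedFDeriv_comp_equiv he hf _ e]
  congr 1
  ext t : 1
  simp [e, Equiv.sigmaFiberEquiv]

lemma norm_le_of_basis_le {l : ℕ} (M : ContinuousMultilinearMap ℝ (fun _ : Fin l => E d) F) {C : ℝ}
    (hC0 : 0 ≤ C)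
    (hC : ∀ v : Fin l → Fin d, ‖M fun t => EuclideanSpace.single (v t) (1 : ℝ)‖ ≤ C) :
    ‖M‖ ≤ d ^ l * C := by
  refine ContinuousMultilinearMap.opNorm_le_bound (by positivity) fun y => ?_
  have hy : y = fun t => ∑ i, y t i • EuclideanSpace.single i (1 : ℝ) := by
    ext t : 1
    simpa using ((EuclideanSpace.basisFun (Fin d) ℝ).sum_repr (y t)).symm
  conv_lhs => rw [hy]
  rw [M.map_sum]
  calc ‖∑ v : Fin l → Fin d, M fun t => y t (v t) • EuclideanSpace.single (v t) (1 : ℝ)‖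
      ≤ ∑ _v : Fin l → Fin d, (∏ t, ‖y t‖) * C := by
        refine norm_sum_le_of_le _ fun v _ => ?_
        rw [M.map_smul_univ, norm_smul, norm_prod]
        refine mul_le_mul (Finset.prod_le_prod (fun t _ => norm_nonneg _) fun t _ => ?_) (hC v)
          (norm_nonneg _) (Finset.prod_nonneg fun t _ => norm_nonneg _)
        exact PiLp.norm_apply_le (y t) (v t)
    _ = _ := by simp; ring

lemma continuousOn_multiDeriv {k : ℕ} {f : E d → F}
    (hf : ContDiffOn ℝ k f (interior (cube d))) {β : Fin d → ℕ} (hβ : ∑ i, β i ≤ k) :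
    ContinuousOn (multiDeriv β f) (interior (cube d)) := by
  have h1 := hf.continuousOn_iteratedFDerivWithin (m := ∑ i, β i) (by exact_mod_cast hβ)
    isOpen_interior.uniqueDiffOn
  have h2 : ContinuousOn (iteratedFDeriv ℝ (∑ i, β i) f) (interior (cube d)) :=
    h1.congr fun x hx => (iteratedFDerivWithin_of_isOpen _ isOpen_interior hx).symm
  exact (ContinuousMultilinearMap.apply ℝ (fun _ : Fin (∑ i, β i) => E d) F
    _).continuous.comp_continuousOn h2

lemma cubeExt_eq {G : Type} [NormedAddCommGroup G] {g : E d → G}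
    (hg : ContinuousOn g (interior (cube d))) {x : E d}
    (hx : x ∈ interior (cube d)) : cubeExt g x = g x :=
  extendFrom_eq (subset_closure hx) (hg x hx)

/-- The Hölder norm controls the derivatives in the interior of the cube. -/
theorem norm_iteratedFDeriv_le_of_holderNorm_le {k : ℕ} {α K : ℝ} (hK : 0 ≤ K) {f : E d → F}
    (hf : MemHolder k α f) (hfK : holderNorm k α f ≤ ENNReal.ofReal K) {l : ℕ} (hl : l ≤ k)
    {x : E d} (hx : x ∈ interior (cube d)) : ‖iteratedFDeriv ℝ l f x‖ ≤ d ^ l * K := by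
  refine norm_le_of_basis_le _ hK fun v => ?_
  have hfx : ContDiffAt ℝ l f x :=
    (hf.1.2.1.contDiffAt (isOpen_interior.mem_nhds hx)).of_le (by exact_mod_cast hl)
  obtain ⟨β, hβ, h⟩ := exists_multiDeriv_eq (F := F) v
  have hβk : ∑ i, β i ≤ k := hβ.le.trans hl
  rw [h hfx, ← cubeExt_eq (continuousOn_multiDeriv hf.1.2.1 hβk) hx]
  have h1 : ‖cubeExt (multiDeriv β f) x‖ₑ ≤ ckNorm k f :=
    le_iSup₂_of_le β hβk (le_iSup₂_of_le x (interior_subset hx) le_rfl)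
  have h2 : ‖cubeExt (multiDeriv β f) x‖ₑ ≤ ENNReal.ofReal K :=
    h1.trans (le_self_add.trans hfK)
  rwa [← ofReal_norm, ENNReal.ofReal_le_ofReal_iff hK] at h2

end DerivativeBounds

/-! ### Generators preserve the open cube -/

section InteriorMapping

variable {d k : ℕ}

/-- The first partial derivatives extend continuously to the boundary, and the derivative is
assembled linearly from them. -/
lemma MemCk.exists_tendsto_fderiv {f : E d → E d} (hk : 1 ≤ k) (hf : MemCk k f) {y : E d}
    (hy : y ∈ cube d) :
    ∃ A, Filter.Tendsto (fderiv ℝ f) (𝓝[interior (cube d)] y) (𝓝 A) := by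
  have hdir : ∀ i : Fin d, ∃ a, Filter.Tendsto
      (fun z => fderiv ℝ f z (EuclideanSpace.single i (1 : ℝ)))
      (𝓝[interior (cube d)] y) (𝓝 a) := fun i => by
    obtain ⟨β, hβ, h⟩ := exists_multiDeriv_eq (F := E d) (fun _ : Fin 1 => i)
    obtain ⟨g, hgc, hg⟩ := hf.2.2 β (hβ.le.trans hk)
    refine ⟨g y, ((hgc y hy).mono interior_subset).congr' ?_⟩
    filter_upwards [self_mem_nhdsWithin] with z hz
    have hfz : ContDiffAt ℝ (1 : ℕ) f z :=
      (hf.2.1.contDiffAt (isOpen_interior.mem_nhds hz)).of_le (by exact_mod_cast hk)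
    rw [hg hz, ← h hfz, iteratedFDeriv_one_apply]
  choose a ha using hdir
  refine ⟨∑ i, (EuclideanSpace.proj i : E d →L[ℝ] ℝ).smulRight (a i), ?_⟩
  have e : ∀ L : E d →L[ℝ] E d, L = ∑ i, (EuclideanSpace.proj i : E d →L[ℝ] ℝ).smulRight
      (L (EuclideanSpace.single i (1 : ℝ))) := fun L => by
    ext1 x
    have hx : x = ∑ i, x i • EuclideanSpace.single i (1 : ℝ) := by
      simpa using ((EuclideanSpace.basisFun (Fin d) ℝ).sum_repr x).symm
    conv_lhs => rw [hx]
    simp only [map_sum, map_smul, sum_apply, ContinuousLinearMap.smulRight_apply]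
    rfl
  rw [show fderiv ℝ f = fun z => ∑ i, (EuclideanSpace.proj i : E d →L[ℝ] ℝ).smulRight
    (fderiv ℝ f z (EuclideanSpace.single i (1 : ℝ))) from funext fun z => e _]
  refine tendsto_finsetSum _ fun i _ => ?_
  exact ((ContinuousLinearMap.smulRightL ℝ (E d) (E d)
    (EuclideanSpace.proj i : E d →L[ℝ] ℝ)).continuous.tendsto _).comp (ha i)

/-- A `C^1` diffeomorphism of the cube (up to the boundary) preserves the interior. -/
theorem mapsTo_interior_cube {φ ψ : E d → E d} (hk : 1 ≤ k) (hφ : MemCk k φ) (hψ : MemCk k ψ)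
    (hmaps : MapsTo φ (cube d) (cube d)) (hinv : LeftInvOn ψ φ (cube d)) :
    MapsTo φ (interior (cube d)) (interior (cube d)) := by
  intro x hx
  have hxn : cube d ∈ 𝓝 x := mem_interior_iff_mem_nhds.1 hx
  have hxc : x ∈ cube d := interior_subset hx
  have hk0 : ((k : ℕ) : WithTop ℕ∞) ≠ 0 := by exact_mod_cast (by omega : k ≠ 0)
  obtain ⟨A, hA⟩ := hψ.exists_tendsto_fderiv hk (hmaps hxc)
  -- The point `φ x` might a priori lie on the boundary; the limit of the derivative still makes `ψ`
  -- differentiable within the cube there.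
  have hψd : HasFDerivWithinAt ψ A (cube d) (φ x) := by
    rw [← closure_interior_cube]
    refine hasFDerivWithinAt_closure_of_tendsto_fderiv (hψ.2.1.differentiableOn hk0)
      (convex_interior_cube d) isOpen_interior (fun y hy => ?_) hA
    rw [closure_interior_cube] at hy
    exact (hψ.1 y hy).mono interior_subset
  have hφx : ContDiffAt ℝ k φ x := hφ.2.1.contDiffAt (isOpen_interior.mem_nhds hx)
  have hstrict := hφx.hasStrictFDerivAt hk0
  have hcomp : HasFDerivAt (ψ ∘ φ) (A.comp (fderiv ℝ φ x)) x :=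
    (hψd.comp x hstrict.hasFDerivAt.hasFDerivWithinAt hmaps).hasFDerivAt hxn
  have hid : HasFDerivAt (ψ ∘ φ) (ContinuousLinearMap.id ℝ (E d)) x :=
    (hasFDerivAt_id x).congr_of_eventuallyEq (by
      filter_upwards [hxn] with z hz using hinv hz)
  have hAD := hcomp.unique hid
  -- The relation `A ∘ Dφ(x) = id` makes `Dφ(x)` injective, hence surjective in finite dimension.
  -- Then `φ` is open at `x`, so the cube, containing `φ '' cube d`, is a neighbourhood of `φ x`.
  have hinj : Function.Injective (fderiv ℝ φ x : E d →ₗ[ℝ] E d) := by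
    refine Function.LeftInverse.injective (g := A) fun v => ?_
    exact congrArg (fun L : E d →L[ℝ] E d => L v) hAD
  have hsurj : (fderiv ℝ φ x : E d →ₗ[ℝ] E d).range = ⊤ :=
    LinearMap.range_eq_top.2 (LinearMap.injective_iff_surjective.1 hinj)
  rw [mem_interior_iff_mem_nhds, ← hstrict.map_nhds_eq_of_surj hsurj]
  exact Filter.mem_map.2 (Filter.mem_of_superset hxn hmaps)

end InteriorMapping

/-! ### Uniform smoothness of the loss functions -/

section Loss

variable {d : ℕ}

/-- The function `log (1 - ξ ∘ φ)` on the cube, extended by zero. -/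
noncomputable def lossFun (φ : E d → E d) (ξ : E d → ℝ) : E d → ℝ :=
  (cube d).indicator fun x => Real.log (1 - ξ (φ x))

lemma contDiffOn_log_one_sub (n : ℕ) :
    ContDiffOn ℝ n (fun y : ℝ => Real.log (1 - y)) (Ioo 0 1) :=
  ContDiffOn.log (contDiff_const.sub contDiff_id).contDiffOn fun y hy => by
    have := hy.2
    linarith

/-- Discriminator values stay in the compact interval `[B, 1 - B]`, away from the singularity of
`log (1 - y)`. -/
lemma exists_bound_log_one_sub {B : ℝ} (hB₀ : 0 < B) (n : ℕ) :
    ∃ C : ℝ, ∀ i ≤ n, ∀ y ∈ Icc B (1 - B),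
      ‖iteratedFDerivWithin ℝ i (fun y => Real.log (1 - y)) (Ioo 0 1) y‖ ≤ C := by
  have hsub : Icc B (1 - B) ⊆ Ioo 0 1 := fun y hy => ⟨by linarith [hy.1], by linarith [hy.2]⟩
  have h1 : ∀ i : ℕ, ∃ C : ℝ, ∀ y ∈ Icc B (1 - B),
      ‖iteratedFDerivWithin ℝ i (fun y => Real.log (1 - y)) (Ioo 0 1) y‖ ≤ C := fun i =>
    isCompact_Icc.exists_bound_of_continuousOn
      ((contDiffOn_log_one_sub i).continuousOn_iteratedFDerivWithin le_rfl
        isOpen_Ioo.uniqueDiffOn |>.mono hsub)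
  choose C hC using h1
  refine ⟨∑ i ∈ Finset.range (n + 1), |C i|, fun i hi y hy => ?_⟩
  exact ((hC i y hy).trans (le_abs_self _)).trans
    (Finset.single_le_sum (f := fun i => |C i|) (fun i _ => abs_nonneg _)
      (Finset.mem_range.2 (by omega)))

/-- Composition of functions with bounded derivatives, in the form needed for iteration. -/
lemma norm_iteratedFDerivWithin_comp_le_pow {E₁ F₁ G₁ : Type} [NormedAddCommGroup E₁]
    [NormedSpace ℝ E₁] [NormedAddCommGroup F₁] [NormedSpace ℝ F₁] [NormedAddCommGroup G₁]
    [NormedSpace ℝ G₁] {g : F₁ → G₁} {f : E₁ → F₁} {s : Set E₁} {t : Set F₁} {n : ℕ}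
    (hg : ContDiffOn ℝ n g t) (hf : ContDiffOn ℝ n f s) (ht : UniqueDiffOn ℝ t)
    (hs : UniqueDiffOn ℝ s) (hst : MapsTo f s t) {x : E₁} (hx : x ∈ s) {C D : ℝ} (hC0 : 0 ≤ C)
    (hD1 : 1 ≤ D) (hC : ∀ i ≤ n, ‖iteratedFDerivWithin ℝ i g t (f x)‖ ≤ C)
    (hD : ∀ i, 1 ≤ i → i ≤ n → ‖iteratedFDerivWithin ℝ i f s x‖ ≤ D ^ i) :
    ∀ i, 1 ≤ i → i ≤ n →
      ‖iteratedFDerivWithin ℝ i (g ∘ f) s x‖ ≤ ((n.factorial * C + 1) * D) ^ i := by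
  intro i hi hin
  have hin' : ((i : ℕ) : WithTop ℕ∞) ≤ n := by exact_mod_cast hin
  have h1 := norm_iteratedFDerivWithin_comp_le hg hf hin' ht hs hst hx
    (fun j hj => hC j (hj.trans hin)) (fun j hj hji => hD j hj (hji.trans hin))
  refine h1.trans ?_
  rw [mul_pow]
  have h2 : (i.factorial : ℝ) ≤ n.factorial := by exact_mod_cast Nat.factorial_le hin
  -- The added `1` makes the base at least `1`, so the prefactor fits inside an `i`-th power and the
  -- bound can feed the next composition.
  have h3 : (i.factorial : ℝ) * C ≤ (n.factorial * C + 1) ^ i := by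
    calc (i.factorial : ℝ) * C ≤ n.factorial * C + 1 := by nlinarith
      _ ≤ _ := le_self_pow₀ (by nlinarith [Nat.cast_nonneg (α := ℝ) n.factorial]) (by omega)
  gcongr

lemma pow_mul_le_pow {d i : ℕ} {K : ℝ} (hK : 0 ≤ K) (hi : 1 ≤ i) :
    (d : ℝ) ^ i * K ≤ ((d + 1) * (K + 1)) ^ i := by
  rw [mul_pow]
  have h1 : K ≤ (K + 1) ^ i :=
    (by linarith : K ≤ K + 1).trans (le_self_pow₀ (by linarith) (by omega))
  gcongr
  linarith

lemma log_one_sub_mem_Icc {B y : ℝ} (hB₀ : 0 < B) (hy : y ∈ Icc B (1 - B)) :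
    Real.log (1 - y) ∈ Icc (-|Real.log B|) 0 := by
  have h1 : B ≤ 1 - y := by linarith [hy.2]
  have h2 := Real.log_le_log hB₀ h1
  exact ⟨(neg_abs_le _).trans h2, Real.log_nonpos (by linarith) (by linarith [hy.1])⟩

lemma lossFun_mem_Icc {k : ℕ} {α K K' B C₁ C₂ : ℝ} (hB₀ : 0 < B) {φ : E d → E d} {ξ : E d → ℝ}
    (hφ : φ ∈ generators d k α K K') (hξ : ξ ∈ discriminators d k α B C₁ C₂) (x : E d) :
    lossFun φ ξ x ∈ Icc (-|Real.log B|) 0 := by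
  unfold lossFun
  by_cases hx : x ∈ cube d
  · rw [indicator_of_mem hx]
    exact log_one_sub_mem_Icc hB₀ (hξ.1 _ (hφ.2.2.1.mapsTo hx))
  · rw [indicator_of_notMem hx]
    exact ⟨neg_nonpos.2 (abs_nonneg _), le_rfl⟩

lemma continuousOn_loss {k : ℕ} {α K K' B C₁ C₂ : ℝ} (hB₀ : 0 < B) {φ : E d → E d} {ξ : E d → ℝ}
    (hφ : φ ∈ generators d k α K K') (hξ : ξ ∈ discriminators d k α B C₁ C₂) :
    ContinuousOn (fun x => Real.log (1 - ξ (φ x))) (cube d) := by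
  refine ContinuousOn.log (continuousOn_const.sub
    (hξ.2.2.1.1.1.comp hφ.1.1.1 hφ.2.2.1.mapsTo)) fun x hx => ?_
  have := (hξ.1 _ (hφ.2.2.1.mapsTo hx)).2
  linarith

lemma measurable_lossFun {k : ℕ} {α K K' B C₁ C₂ : ℝ} (hB₀ : 0 < B) {φ : E d → E d} {ξ : E d → ℝ}
    (hφ : φ ∈ generators d k α K K') (hξ : ξ ∈ discriminators d k α B C₁ C₂) :
    Measurable (lossFun φ ξ) := by
  classical
  have := (continuousOn_loss hB₀ hφ hξ).measurable_piecewise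
    (g := 0) continuousOn_const (measurableSet_cube d)
  rwa [Set.piecewise_eq_indicator] at this

lemma SmoothBound.congr {n : ℕ} {A : ℝ} {f g : E d → ℝ} (hf : SmoothBound n A f)
    (h : EqOn g f (interior (cube d))) : SmoothBound n A g where
  contDiffOn := hf.contDiffOn.congr h
  abs_le x hx := by rw [h hx]; exact hf.abs_le x hx
  norm_le x hx := by
    have : g =ᶠ[𝓝 x] f := by
      filter_upwards [isOpen_interior.mem_nhds hx] with y hy using h hy
    rw [(this.iteratedFDeriv ℝ (n + 1)).self_of_nhds]
    exact hf.norm_le x hx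

/-- The functions `log (1 - ξ ∘ φ)` have uniformly bounded derivatives up to order `k - 1`. -/
theorem exists_smoothBound_lossFun (d n : ℕ) (α : ℝ) {K K' B C₁ C₂ : ℝ} (hK : 0 < K)
    (hB₀ : 0 < B) (hC₂ : 0 < C₂) :
    ∃ A : ℝ, ∀ φ ∈ generators d (n + 2) α K K', ∀ ξ ∈ discriminators d (n + 2) α B C₁ C₂,
      SmoothBound n A (lossFun φ ξ) := by
  obtain ⟨G, hG⟩ := exists_bound_log_one_sub hB₀ (n + 1)
  -- `D` controls the derivatives of `φ`, `C` those of `ξ`, and `H` those of `ξ ∘ φ`; a second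
  -- composition, with `log (1 - y)`, gives the final constant.
  set D : ℝ := (d + 1) * (K + 1) with hD
  have hD1 : 1 ≤ D := by
    have : (0 : ℝ) ≤ d := Nat.cast_nonneg d
    nlinarith
  set C : ℝ := (d + 1) ^ (n + 1) * C₂ with hC
  have hC0 : 0 ≤ C := by positivity
  set H : ℝ := ((n + 1).factorial * C + 1) * D with hH
  have hH1 : 1 ≤ H := one_le_mul_of_one_le_of_one_le (by
    have : 0 ≤ ((n + 1).factorial : ℝ) * C := by positivity
    linarith) hD1
  refine ⟨max ((((n + 1).factorial * |G| + 1) * H) ^ (n + 1)) |Real.log B|,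
    fun φ hφ ξ hξ => ?_⟩
  set U := interior (cube d) with hU
  have hUo : IsOpen U := isOpen_interior
  obtain ⟨ψ, hinv, hψ, -⟩ := hφ.2.2.2
  have hmaps : MapsTo φ U U :=
    mapsTo_interior_cube (by omega) hφ.1.1 hψ.1 hφ.2.2.1.mapsTo hinv.1
  have hφc : ContDiffOn ℝ (n + 1 : ℕ) φ U := hφ.1.1.2.1.of_le (by norm_cast; omega)
  have hξc : ContDiffOn ℝ (n + 1 : ℕ) ξ U := hξ.2.2.1.1.2.1
  have hξmem : ∀ x ∈ U, ξ (φ x) ∈ Icc B (1 - B) := fun x hx =>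
    hξ.1 _ (hφ.2.2.1.mapsTo (interior_subset hx))
  have hsub : Icc B (1 - B) ⊆ Ioo 0 1 := fun y hy => ⟨by linarith [hy.1], by linarith [hy.2]⟩
  have hcomp : ContDiffOn ℝ (n + 1 : ℕ) (ξ ∘ φ) U := hξc.comp hφc hmaps
  have hmaps2 : MapsTo (ξ ∘ φ) U (Ioo 0 1) := fun x hx => hsub (hξmem x hx)
  have hb1 : ∀ x ∈ U, ∀ i, 1 ≤ i → i ≤ n + 1 → ‖iteratedFDerivWithin ℝ i (ξ ∘ φ) U x‖ ≤ H ^ i :=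
    fun x hx => norm_iteratedFDerivWithin_comp_le_pow hξc hφc hUo.uniqueDiffOn hUo.uniqueDiffOn
      hmaps hx hC0 hD1
      (fun i hi => by
        rw [iteratedFDerivWithin_of_isOpen i hUo (hmaps hx)]
        refine (norm_iteratedFDeriv_le_of_holderNorm_le hC₂.le hξ.2.2.1 hξ.2.2.2 hi
          (hmaps hx)).trans ?_
        have h1 : (d : ℝ) ^ i ≤ (d + 1) ^ (n + 1) := by
          calc (d : ℝ) ^ i ≤ (d + 1) ^ i := by gcongr; linarith
            _ ≤ _ := pow_le_pow_right₀ (by linarith [Nat.cast_nonneg (α := ℝ) d]) hi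
        exact mul_le_mul_of_nonneg_right h1 hC₂.le)
      (fun i hi hin => by
        rw [iteratedFDerivWithin_of_isOpen i hUo hx]
        exact (norm_iteratedFDeriv_le_of_holderNorm_le hK.le hφ.1 hφ.2.1 (by omega) hx).trans
          (pow_mul_le_pow hK.le hi))
  have hb2 : ∀ x ∈ U, ‖iteratedFDerivWithin ℝ (n + 1) ((fun y => Real.log (1 - y)) ∘ (ξ ∘ φ)) U x‖
      ≤ (((n + 1).factorial * |G| + 1) * H) ^ (n + 1) := fun x hx =>
    norm_iteratedFDerivWithin_comp_le_pow (contDiffOn_log_one_sub (n + 1)) hcomp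
      isOpen_Ioo.uniqueDiffOn hUo.uniqueDiffOn hmaps2 hx (abs_nonneg G) hH1
      (fun i hi => (hG i hi _ (hξmem x hx)).trans (le_abs_self G)) (hb1 x hx)
      (n + 1) (by omega) le_rfl
  have hbound : SmoothBound n (max ((((n + 1).factorial * |G| + 1) * H) ^ (n + 1)) |Real.log B|)
      ((fun y => Real.log (1 - y)) ∘ (ξ ∘ φ)) :=
    { contDiffOn := (contDiffOn_log_one_sub (n + 1)).comp hcomp hmaps2
      abs_le := fun x hx => (abs_le_of_mem_Icc_neg
        (log_one_sub_mem_Icc hB₀ (hξmem x hx))).trans (le_max_right _ _)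
      norm_le := fun x hx => by
        rw [← iteratedFDerivWithin_of_isOpen (n + 1) hUo hx]
        exact (hb2 x hx).trans (le_max_left _ _) }
  exact hbound.congr fun x hx => indicator_of_mem (interior_subset hx) _

end Loss

/-! ### Reduction to a countable family -/

section GeneralizationError

variable {d : ℕ}

lemma empNoiseRisk_sub_noiseRisk_eq {z : ℕ → E d} (hz : ∀ i, z i ∈ cube d) (n : ℕ)
    (φ : E d → E d) (ξ : E d → ℝ) :
    empNoiseRisk z n φ ξ - noiseRisk φ ξ
      = empDev (noiseMeasure d) (fun i : Fin n => z i) (lossFun φ ξ) := by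
  have h1 : ∫ x, lossFun φ ξ x ∂(noiseMeasure d) = noiseRisk φ ξ :=
    integral_congr_ae (by
      filter_upwards [ae_restrict_mem (measurableSet_cube d)] with x hx
      exact indicator_of_mem hx _)
  rw [empDev, h1, empNoiseRisk, Finset.sum_range]
  have h2 : ∀ i : Fin n, lossFun φ ξ (z i) = Real.log (1 - ξ (φ (z i))) := fun i =>
    indicator_of_mem (hz i) _
  simp_rw [h2]

lemma abs_empDev_le_supDev_of_approx {μ : Measure (E d)} [IsProbabilityMeasure μ] {M : ℝ}
    {f : ℕ → E d → ℝ} (hfm : ∀ k, Measurable (f k)) (hfM : ∀ k x, f k x ∈ Icc (-M) 0)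
    {g : E d → ℝ} (hgm : Measurable g) (hgM : ∀ x, g x ∈ Icc (-M) 0)
    (happrox : ∀ ε > 0, ∃ k, ∀ x, |g x - f k x| ≤ ε) {n : ℕ} (z : Fin n → E d) :
    |empDev μ z g| ≤ supDev μ f z := by
  refine le_of_forall_pos_le_add fun ε hε => ?_
  obtain ⟨k, hk⟩ := happrox (ε / 2) (by linarith)
  have hint : ∀ {h : E d → ℝ}, Measurable h → (∀ x, h x ∈ Icc (-M) 0) → Integrable h μ :=
    fun hm hM => Integrable.of_bound hm.aestronglyMeasurable M
      (Filter.Eventually.of_forall fun x => abs_le_of_mem_Icc_neg (hM x))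
  have h1 := abs_empDev_le μ z (f := fun x => g x - f k x) (by linarith : 0 ≤ ε / 2)
    (fun i => hk _) (Filter.Eventually.of_forall hk)
  rw [empDev_sub μ z (hint hgm hgM) (hint (hfm k) (hfM k))] at h1
  have h2 : |empDev μ z (f k)| ≤ supDev μ f z := le_ciSup (bddAbove_abs_empDev hfM z) k
  have h3 := abs_add_le (empDev μ z (f k)) (empDev μ z g - empDev μ z (f k))
  rw [add_sub_cancel] at h3
  linarith

/-- A family of functions that are continuous on the cube and vanish outside has a countable
subfamily that is dense for uniform convergence. -/
lemma exists_seq_uniformly_dense {𝓕 : Set (E d → ℝ)} (hne : 𝓕.Nonempty)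
    (hcont : ∀ f ∈ 𝓕, ContinuousOn f (cube d)) (hzero : ∀ f ∈ 𝓕, ∀ x ∉ cube d, f x = 0) :
    ∃ u : ℕ → E d → ℝ, (∀ k, u k ∈ 𝓕) ∧
      ∀ f ∈ 𝓕, ∀ ε > 0, ∃ k, ∀ x, |f x - u k x| ≤ ε := by
  have : CompactSpace (cube d) := isCompact_iff_compactSpace.1 (isCompact_cube d)
  -- `C(cube d, ℝ)` is a separable metric space because the cube is compact, so the range of `r` has
  -- a dense sequence. Members of `𝓕` vanish off the cube, hence closeness there is closeness
  -- everywhere.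
  let r : 𝓕 → C(cube d, ℝ) := fun f => ⟨(cube d).domRestrict f.1, (hcont f.1 f.2).domRestrict⟩
  have : Nonempty (range r) := (range_nonempty_iff_nonempty.2 hne.to_subtype).to_subtype
  obtain ⟨v, hv⟩ := TopologicalSpace.exists_dense_seq (range r)
  choose u hu using fun k => (v k).2
  refine ⟨fun k => (u k).1, fun k => (u k).2, fun f hf ε hε => ?_⟩
  obtain ⟨k, hk⟩ := hv.exists_dist_lt ⟨r ⟨f, hf⟩, mem_range_self _⟩ hε
  refine ⟨k, fun x => ?_⟩
  by_cases hx : x ∈ cube d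
  · have h1 : dist (r ⟨f, hf⟩) (r (u k)) < ε := by rw [hu]; exact hk
    exact ((ContinuousMap.dist_apply_le_dist ⟨x, hx⟩).trans h1.le)
  · simpa [hzero f hf x hx, hzero _ (u k).2 x hx] using hε.le

end GeneralizationError

end GAL

/-! ### The main theorem -/

theorem theorem5p3
    (d : ℕ) (hd : 1 ≤ d)
    (k : ℕ) (hk : 2 ≤ k)
    (α : ℝ) (hα₀ : 0 < α) (hα₁ : α ≤ 1)
    (hreg : 2 - α + (d : ℝ) / 2 < (k : ℝ))
    (K K' : ℝ) (hK : 0 < K) (hK' : 0 < K')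
    (B : ℝ) (hB₀ : 0 < B) (hB₁ : B < 1 / 2)
    (C₁ C₂ : ℝ) (hC₁ : 0 < C₁) (hC₂ : 0 < C₂)
    {Ω : Type*} [MeasurableSpace Ω] (P : Measure Ω) [IsProbabilityMeasure P]
    (Z : ℕ → Ω → GAL.E d) (hZ : ∀ i, Measurable (Z i))
    (hZ_law : ∀ i, P.map (Z i) = GAL.noiseMeasure d) (hZ_indep : iIndepFun Z P)
    (τ : ℝ) (hτ : √(2 * (Real.log B) ^ 2) < τ) :
    ∀ᵐ ω ∂P, ∃ N : ℕ, ∀ n : ℕ, N ≤ n →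
      GAL.noiseGenError (GAL.generators d k α K K') (GAL.discriminators d k α B C₁ C₂)
          (fun i => Z i ω) n
        < ENNReal.ofReal (τ * √(Real.log n / n)) := by
  have hτ0 : 0 < τ := (Real.sqrt_nonneg _).trans_lt hτ
  obtain ⟨n, rfl⟩ : ∃ n, k = n + 2 := ⟨k - 2, by omega⟩
  set 𝓕 : Set (GAL.E d → ℝ) := {f | ∃ φ ∈ GAL.generators d (n + 2) α K K',
    ∃ ξ ∈ GAL.discriminators d (n + 2) α B C₁ C₂, f = GAL.lossFun φ ξ} with h𝓕
  -- At `m = 1` the logarithm vanishes and the strict inequality would fail for an empty class, so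
  -- the threshold is kept at least `2`.
  have hpos : ∀ m : ℕ, 2 ≤ m → 0 < τ * √(Real.log m / m) := fun m hm => by
    have h1 : (1 : ℝ) < m := by exact_mod_cast hm
    have h2 := Real.log_pos h1
    positivity
  rcases 𝓕.eq_empty_or_nonempty with hempty | hne
  · refine Filter.Eventually.of_forall fun ω => ⟨2, fun m hm => ?_⟩
    have : GAL.noiseGenError (GAL.generators d (n + 2) α K K')
        (GAL.discriminators d (n + 2) α B C₁ C₂) (fun i => Z i ω) m ≤ 0 :=
      iSup₂_le fun φ hφ => iSup₂_le fun ξ hξ =>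
        absurd ⟨φ, hφ, ξ, hξ, rfl⟩ (eq_empty_iff_forall_notMem.1 hempty (GAL.lossFun φ ξ))
    exact this.trans_lt (ENNReal.ofReal_pos.2 (hpos m hm))
  -- As `α ≤ 1`, the regularity condition gives `d / 2 < n + α ≤ n + 1 = k - 1`.
  have hdn : d < 2 * (n + 1) := by
    have h1 : (d : ℝ) < 2 * (n + 1) := by push_cast at hreg; linarith
    exact_mod_cast h1
  have hm : ∀ f ∈ 𝓕, Measurable f := by
    rintro _ ⟨φ, hφ, ξ, hξ, rfl⟩
    exact GAL.measurable_lossFun hB₀ hφ hξ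
  have hM : ∀ f ∈ 𝓕, ∀ x, f x ∈ Icc (-|Real.log B|) 0 := by
    rintro _ ⟨φ, hφ, ξ, hξ, rfl⟩
    exact GAL.lossFun_mem_Icc hB₀ hφ hξ
  obtain ⟨A, hA⟩ := GAL.exists_smoothBound_lossFun d n α (K := K) (K' := K') (C₁ := C₁)
    hK hB₀ hC₂
  obtain ⟨u, hu, hdense⟩ := GAL.exists_seq_uniformly_dense hne (by
      rintro _ ⟨φ, hφ, ξ, hξ, rfl⟩
      exact (GAL.continuousOn_loss hB₀ hφ hξ).congr fun x hx => indicator_of_mem hx _) (by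
      rintro _ ⟨φ, hφ, ξ, hξ, rfl⟩ x hx
      exact indicator_of_notMem hx _)
  have hsmooth : ∀ j, GAL.SmoothBound n A (u j) := fun j => by
    obtain ⟨φ, hφ, ξ, hξ, h⟩ := hu j
    rw [h]
    exact hA φ hφ ξ hξ
  obtain ⟨C, hC⟩ := GAL.exists_integral_supDev_le hdn A |Real.log B|
  have hB1 : Real.log B < 0 := Real.log_neg hB₀ (by linarith)
  have hτ' : √2 * |Real.log B| < τ := by
    rwa [Real.sqrt_mul (by norm_num), Real.sqrt_sq_eq_abs] at hτ
  have hmain := GAL.ae_eventually_supDev_lt (abs_pos.2 hB1.ne) (fun j => hm _ (hu j))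
    (fun j => hM _ (hu j))
    (hC u (fun j => hm _ (hu j)) (fun j => hM _ (hu j)) hsmooth) P hZ hZ_law hZ_indep hτ'
  have hcube : ∀ᵐ ω ∂P, ∀ i, Z i ω ∈ GAL.cube d := by
    rw [ae_all_iff]
    intro i
    have h1 : ∀ᵐ x ∂(P.map (Z i)), x ∈ GAL.cube d := by
      rw [hZ_law i]
      exact ae_restrict_mem (GAL.measurableSet_cube d)
    exact ae_of_ae_map (hZ i).aemeasurable h1
  filter_upwards [hmain, hcube] with ω hω hcω
  obtain ⟨N, hN⟩ := Filter.eventually_atTop.1 hω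
  refine ⟨max N 2, fun m hmN => ?_⟩
  have h1 := hN m ((le_max_left _ _).trans hmN)
  refine lt_of_le_of_lt (iSup₂_le fun φ hφ => iSup₂_le fun ξ hξ => ?_)
    ((ENNReal.ofReal_lt_ofReal_iff (hpos m ((le_max_right _ _).trans hmN))).2 h1)
  refine ENNReal.ofReal_le_ofReal ?_
  have hf : GAL.lossFun φ ξ ∈ 𝓕 := ⟨φ, hφ, ξ, hξ, rfl⟩
  rw [GAL.empNoiseRisk_sub_noiseRisk_eq hcω]
  exact GAL.abs_empDev_le_supDev_of_approx (fun j => hm _ (hu j)) (fun j => hM _ (hu j)) (hm _ hf)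
    (hM _ hf) (hdense _ hf) _
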